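/- **Setting.** Let $d\ge 1$, let $X\subset\mathbb R^d$ be a nonempty compact set, $\rho$ a metric on $\mathbb R^d$, and $\Phi=\{\phi_1,\dots,\phi_m\}$, $m\ge2$, maps from $X$ to $X$. Let $\Phi_n=\Phi$ for all $n\ge1$, and assume that $\{\Phi_n\}$ is a Moran-type IFS (MIFS) on $(X,\rho)$: there are $0<c_{1,n}\le c_{2,n}<1$ with $\prod_{j\le n}c_{2,j}\to0$ and $$c_{1,n}\,\rho(x,y)\le\rho(\phi_j(x),\phi_j(y))\le c_{2,n}\,\rho(x,y)\qquad(x,y\in X,\ 1\le j\le m,\ n\ge1).\tag{1}$$ For a word $J=j_1\cdots j_k$ over $\{1,\dots,m\}$ put $|J|=k$, $\phi_J=\phi_{j_1}\circ\cdots\circ\phi_{j_k}$, $J^-=j_1\cdots j_{k-1}$, and let $R_J=\sup_{x\ne y\in X}\rho(\phi_J(x),\phi_J(y))/\rho(x,y)$; for $0<b<1$ let $\mathcal I_b=\{J: R_J\le b<R_{J^-}\}$. Let $K_n$ be the set of all limits $\lim_k\phi_{j_nj_{n+1}\cdots j_{n+k}}(a)$ over infinite words $j_nj_{n+1}\cdots$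 (they do not depend on $a\in X$). $\mathcal L^d$ is Lebesgue measure. Suppose that one of the following holds. (A) $\Phi$ is generalized self-affine: $\phi_j(x)=A_j^{-1}(x+\alpha_j)$ on $X$ with invertible matrices $A_j$ and $\alpha_j\in\mathbb R^d$; $\rho$ and the Euclidean metric are bi-Lipschitz equivalent on $X$; and, with $A_{j_1\cdots j_k}=A_{j_k}\cdots A_{j_1}$ and $\Gamma_b=\{J:|\det A_J^{-1}|\le b^d<|\det A_{J^-}^{-1}|\}$, $$\sup\{\|A_IA_J^{-1}\|: I,J\in\Gamma_b,\ 0<b<1\}<\infty.$$ (B) $\Phi$ is self-conformal with bounded distortion: $\rho$ is the Euclidean metric; there is a set $X_1\subset\mathbb R^d$ with $X\subset X_1^\circ$ such that the $\phi_j$ extend to maps of $X_1$ into itself that satisfy (1) on $X_1$ for the Euclidean metric (with constants of the same kind) and are $C^1$ and conformal on $X_1^\circ$; and there is a constant $C$ with $|\phi_J'(x)|\le C|\phi_J'(y)|$ for all words $J$ and all $x,y\in X_1^\circ$. **Separation conditions.** * MOSC: there are open sets $V_n\subset X$ of $\mathbb R^d$ with $\inf_n\mathcal L^d(V_n)>0$,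 $\phi_j(V_{n+1})\subset V_n$ and $\phi_i(V_{n+1})\cap\phi_j(V_{n+1})=\emptyset$ for all $n\ge1$ and $i\ne j$. OSC: there is a nonempty open set $V\subset X$ of $\mathbb R^d$ with $\phi_j(V)\subset V$ and $\phi_i(V)\cap\phi_j(V)=\emptyset$ for all $i\ne j$. * MWSC: there are measurable sets $U_n\subset X$ with $\inf_n\mathcal L^d(U_n)>0$ and $$\sup_{0<b<1}\ \sup_{I\in\mathcal I_b}\#\{\phi_J: J\in\mathcal I_b,\ \phi_J(U_{|J|+1})\cap\phi_I(U_{|I|+1})\ne\emptyset\}<\infty,$$ where distinct maps on $X$ are counted. WSC: there is one measurable set $U\subset X$ with $\mathcal L^d(U)>0$ and $$\sup_{0<b<1}\ \sup_{I\in W_b}\#\{\phi_J: J\in W_b,\ \phi_J(U)\cap\phi_I(U)\ne\emptyset\}<\infty,$$ where $W_b=\Gamma_b$ in case (A) and $W_b=\mathcal I_b$ in case (B). * MSSC: $\phi_I(K_{n+1})\cap\phi_J(K_{n+1})=\emptyset$ for all $n\ge1$ and all distinct words $I,J$ of length $n$. SSC: $\phi_i(K)\cap\phi_j(K)=\emptyset$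 for all $i\ne j$, where $K\subset X$ is the attractor of $\Phi$, the nonempty compact set with $K=\bigcup_j\phi_j(K)$. **Theorem.** $K_n=K_1$ for all $n\ge1$, and (i) $\{\Phi_n\}$ satisfies the MOSC if and only if $\Phi$ satisfies the OSC; (ii) $\{\Phi_n\}$ satisfies the MWSC if and only if $\Phi$ satisfies the WSC; in case (B), if $X^\circ\ne\emptyset$, the WSC may here also be taken in its pointwise form: there are a set $D\subset X$ with $D^\circ\neq\emptyset$ and $\phi_j(D)\subset D$ for all $j$, and a $\gamma\in\mathbb N$, such that $\#\{\phi_J: J\in\mathcal I_b,\ x\in\phi_J(D)\}\le\gamma$ for all $0<b<1$ and $x\in X$; (iii) $\{\Phi_n\}$ satisfies the MSSC if and only if $\Phi$ satisfies the SSC. -/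

import Mathlib

open Set Filter Topology MeasureTheory

noncomputable section

/-- Euclidean space `ℝ^d`. -/
abbrev Euc (d : ℕ) : Type := EuclideanSpace ℝ (Fin d)

/-- The Euclidean metric on `ℝ^d`. -/
@[reducible] def eucMetric (d : ℕ) : MetricSpace (Euc d) := inferInstance

/-- The distance function of a metric on `ℝ^d` that need not be the Euclidean one. -/
def rdist {d : ℕ} (ρ : MetricSpace (Euc d)) (x y : Euc d) : ℝ :=
  ρ.toPseudoMetricSpace.toDist.dist x y

/-- A sequence `Φ_n = {φ_{n,j}}`, `j < N n`, of finite families of maps. Layers are numbered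
from `0`, so layer `n` here is the layer usually called `n + 1`. The maps are total functions on
`ℝ^d`; only their values on the base set `X` (or on a neighbourhood, when an extension is meant)
are ever used. -/
structure MapSeq (d : ℕ) where
  /-- the number of maps in a layer -/
  N : ℕ → ℕ
  /-- the maps -/
  map : (n : ℕ) → Fin (N n) → Euc d → Euc d

namespace MapSeq

variable {d : ℕ}

/-- The constant sequence `Φ_n = Φ`. -/
def const {m : ℕ} (φ : Fin m → Euc d → Euc d) : MapSeq d where
  N := fun _ => m
  map := fun _ => φ

/-- The sequence `Φ_n, Φ_{n+1}, …`. -/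
def tail (Φ : MapSeq d) (n : ℕ) : MapSeq d where
  N := fun k => Φ.N (n + k)
  map := fun k => Φ.map (n + k)

/-- The displayed condition on the maps of a Moran-type IFS: every map sends `X` into itself and is
bi-Lipschitz on `X` for `ρ` with constants `0 < c₁ n ≤ c₂ n < 1`, and the products of the `c₂`
tend to zero. -/
def ContractsOn (Φ : MapSeq d) (X : Set (Euc d)) (ρ : MetricSpace (Euc d)) : Prop :=
  ∃ c₁ c₂ : ℕ → ℝ,
    (∀ n, 0 < c₁ n ∧ c₁ n ≤ c₂ n ∧ c₂ n < 1) ∧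
    Tendsto (fun n => ∏ j ∈ Finset.range n, c₂ j) atTop (𝓝 0) ∧
    ∀ n, ∀ j : Fin (Φ.N n), MapsTo (Φ.map n j) X X ∧
      ∀ x ∈ X, ∀ y ∈ X,
        c₁ n * rdist ρ x y ≤ rdist ρ (Φ.map n j x) (Φ.map n j y) ∧
        rdist ρ (Φ.map n j x) (Φ.map n j y) ≤ c₂ n * rdist ρ x y

/-- `Φ` is a Moran-type iterated function system on `(X, ρ)`. -/
structure IsMIFS (Φ : MapSeq d) (X : Set (Euc d)) (ρ : MetricSpace (Euc d)) : Prop where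
  compact : IsCompact X
  nonempty : X.Nonempty
  two_le : ∀ n, 2 ≤ Φ.N n
  contracts : Φ.ContractsOn X ρ

/-- `φ_{1,J} = φ_{1,j_1} ∘ ⋯ ∘ φ_{k,j_k}` for a word `J = j_1 ⋯ j_k` of length `k`. -/
def comp (Φ : MapSeq d) : (k : ℕ) → ((i : Fin k) → Fin (Φ.N i)) → Euc d → Euc d
  | 0, _ => id
  | k + 1, w => comp Φ k (fun i => w i.castSucc) ∘ Φ.map k (w (Fin.last k))

end MapSeq

/-- Finite words starting from the first layer, with the alphabet `Fin (N n)` in layer `n`. -/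
abbrev Word (N : ℕ → ℕ) : Type := Σ k : ℕ, (i : Fin k) → Fin (N i)

/-- Delete the last letter of a word (the empty word is left alone). -/
def Word.dropLast {N : ℕ → ℕ} : Word N → Word N
  | ⟨0, w⟩ => ⟨0, w⟩
  | ⟨k + 1, w⟩ => ⟨k, fun i => w i.castSucc⟩

namespace MapSeq

variable {d : ℕ}

/-- The map `φ_{1,J}`. -/
def wordMap (Φ : MapSeq d) (J : Word Φ.N) : Euc d → Euc d := Φ.comp J.1 J.2

/-- The upper contraction ratio `R_J` of `φ_{1,J}` on `(X, ρ)`. -/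
def upperRatio (Φ : MapSeq d) (X : Set (Euc d)) (ρ : MetricSpace (Euc d)) (J : Word Φ.N) : ℝ :=
  sSup {r : ℝ | ∃ x ∈ X, ∃ y ∈ X, x ≠ y ∧
    r = rdist ρ (Φ.wordMap J x) (Φ.wordMap J y) / rdist ρ x y}

/-- The set of words `𝓘_b = {J : R_J ≤ b < R_{J⁻}}`, with `J⁻` the word `J` without its last
letter. The empty word never belongs to it. -/
def cut (Φ : MapSeq d) (X : Set (Euc d)) (ρ : MetricSpace (Euc d)) (b : ℝ) : Set (Word Φ.N) :=
  {J | Φ.upperRatio X ρ J ≤ b ∧ b < Φ.upperRatio X ρ J.dropLast}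

/-- The set of all limits `lim_k φ_{1, j_1 ⋯ j_k}(a)` over infinite words, for `a ∈ X` (the limit
being the same for all `a`). -/
def limitSet (Φ : MapSeq d) (X : Set (Euc d)) : Set (Euc d) :=
  {z | ∃ j : (k : ℕ) → Fin (Φ.N k), ∀ a ∈ X,
    Tendsto (fun k => Φ.comp k (fun i => j i) a) atTop (𝓝 z)}

/-- The Moran-type invariant set `K_n` (again numbered from `0`). -/
def attractor (Φ : MapSeq d) (X : Set (Euc d)) (n : ℕ) : Set (Euc d) :=
  (Φ.tail n).limitSet X

/-- Moran-type open set condition. -/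
def MOSC (Φ : MapSeq d) (X : Set (Euc d)) : Prop :=
  ∃ V : ℕ → Set (Euc d),
    (∀ n, IsOpen (V n) ∧ V n ⊆ X) ∧
    (∀ n, ∀ j : Fin (Φ.N n), Φ.map n j '' V (n + 1) ⊆ V n) ∧
    (∀ n, ∀ i j : Fin (Φ.N n), i ≠ j →
      Disjoint (Φ.map n i '' V (n + 1)) (Φ.map n j '' V (n + 1))) ∧
    0 < ⨅ n, volume (V n)

/-- Moran-type weak separation condition. What is counted are the maps `φ_{1,J}` on `X`, not the
words `J`. -/
def MWSC (Φ : MapSeq d) (X : Set (Euc d)) (ρ : MetricSpace (Euc d)) : Prop :=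
  ∃ U : ℕ → Set (Euc d),
    (∀ n, U n ⊆ X ∧ NullMeasurableSet (U n) volume) ∧
    0 < ⨅ n, volume (U n) ∧
    ∃ γ : ℕ, ∀ b : ℝ, 0 < b → b < 1 → ∀ I ∈ Φ.cut X ρ b,
      {f : X → Euc d | ∃ J ∈ Φ.cut X ρ b,
        f = X.domRestrict (Φ.wordMap J) ∧
        (Φ.wordMap J '' U J.1 ∩ Φ.wordMap I '' U I.1).Nonempty}.encard ≤ γ

/-- Moran-type strong separation condition. -/
def MSSC (Φ : MapSeq d) (X : Set (Euc d)) : Prop :=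
  ∀ n : ℕ, 0 < n → ∀ I J : (i : Fin n) → Fin (Φ.N i), I ≠ J →
    Disjoint (Φ.comp n J '' Φ.attractor X n) (Φ.comp n I '' Φ.attractor X n)

end MapSeq

section IFS

variable {d m : ℕ}

/-- Open set condition for the IFS `φ` on `X`. -/
def OSC (φ : Fin m → Euc d → Euc d) (X : Set (Euc d)) : Prop :=
  ∃ V : Set (Euc d), IsOpen V ∧ V.Nonempty ∧ V ⊆ X ∧
    (∀ j, φ j '' V ⊆ V) ∧ ∀ i j, i ≠ j → Disjoint (φ i '' V) (φ j '' V)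

/-- Weak separation condition for the IFS `φ` on `X`, where `W b` is the set of words "of
size `b`". What is counted are the maps `φ_J` on `X`, not the words `J`. -/
def WSC (φ : Fin m → Euc d → Euc d) (X : Set (Euc d))
    (W : ℝ → Set (Word (MapSeq.const φ).N)) : Prop :=
  ∃ U : Set (Euc d), U ⊆ X ∧ NullMeasurableSet U volume ∧ 0 < volume U ∧
    ∃ γ : ℕ, ∀ b : ℝ, 0 < b → b < 1 → ∀ I ∈ W b,
      {f : X → Euc d | ∃ J ∈ W b,
        f = X.domRestrict ((MapSeq.const φ).wordMap J) ∧
        ((MapSeq.const φ).wordMap J '' U ∩ (MapSeq.const φ).wordMap I '' U).Nonempty}.encard ≤ γ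

/-- Weak separation condition for the IFS `φ` on `X` in its pointwise form: some `D ⊆ X` with
nonempty interior is invariant under the maps, and no point of `X` lies in more than `γ` of the sets
`f(D)`, where `f` runs through the distinct maps `φ_J` on `X` with `J ∈ W b`. -/
def PointwiseWSC (φ : Fin m → Euc d → Euc d) (X : Set (Euc d))
    (W : ℝ → Set (Word (MapSeq.const φ).N)) : Prop :=
  ∃ D : Set (Euc d), D ⊆ X ∧ (interior D).Nonempty ∧ (∀ j, φ j '' D ⊆ D) ∧
    ∃ γ : ℕ, ∀ b : ℝ, 0 < b → b < 1 → ∀ x ∈ X,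
      {f : X → Euc d | ∃ J ∈ W b,
        f = X.domRestrict ((MapSeq.const φ).wordMap J) ∧
        x ∈ (MapSeq.const φ).wordMap J '' D}.encard ≤ γ

/-- `K` is the attractor of the IFS `φ` on `X`. -/
def IsAttractor (φ : Fin m → Euc d → Euc d) (X K : Set (Euc d)) : Prop :=
  K ⊆ X ∧ K.Nonempty ∧ IsCompact K ∧ K = ⋃ j, φ j '' K

/-- Strong separation condition for the IFS `φ` on `X`. -/
def SSC (φ : Fin m → Euc d → Euc d) (X : Set (Euc d)) : Prop :=
  ∃ K : Set (Euc d), IsAttractor φ X K ∧ ∀ i j, i ≠ j → Disjoint (φ i '' K) (φ j '' K)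

/-- `A_J = A_{j_k} ⋯ A_{j_1}` for `J = j_1 ⋯ j_k`, so that `A_J⁻¹ = A_{j_1}⁻¹ ⋯ A_{j_k}⁻¹`. -/
def wordMatrix (A : Fin m → (Euc d ≃L[ℝ] Euc d)) :
    (k : ℕ) → (Fin k → Fin m) → (Euc d ≃L[ℝ] Euc d)
  | 0, _ => ContinuousLinearEquiv.refl ℝ (Euc d)
  | k + 1, w => (wordMatrix A k (fun i => w i.castSucc)).trans (A (w (Fin.last k)))

/-- `|det A_J⁻¹|`. -/
def detRatio (A : Fin m → (Euc d ≃L[ℝ] Euc d)) (J : Word (fun _ => m)) : ℝ :=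
  |LinearMap.det ((wordMatrix A J.1 J.2).symm : Euc d →ₗ[ℝ] Euc d)|

/-- The set of words `Γ_b = {J : |det A_J⁻¹| ≤ b^d < |det A_{J⁻}⁻¹|}`. -/
def detCut (A : Fin m → (Euc d ≃L[ℝ] Euc d)) (b : ℝ) : Set (Word (fun _ => m)) :=
  {J | detRatio A J ≤ b ^ d ∧ b ^ d < detRatio A J.dropLast}

/-- On `X` the maps are the affine maps `φ_j(x) = A_j⁻¹ (x + α_j)` with invertible `A_j`. -/
def IsGenSelfAffine (φ : Fin m → Euc d → Euc d) (X : Set (Euc d))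
    (A : Fin m → (Euc d ≃L[ℝ] Euc d)) (α : Fin m → Euc d) : Prop :=
  ∀ j, ∀ x ∈ X, φ j x = (A j).symm (x + α j)

/-- `sup {‖A_I A_J⁻¹‖ : I, J ∈ Γ_b, 0 < b < 1} < ∞`. -/
def WeaklyHomogeneous (A : Fin m → (Euc d ≃L[ℝ] Euc d)) : Prop :=
  ∃ τ : ℝ, ∀ b : ℝ, 0 < b → b < 1 → ∀ I ∈ detCut A b, ∀ J ∈ detCut A b,
    ‖((wordMatrix A J.1 J.2).symm.trans (wordMatrix A I.1 I.2) : Euc d →L[ℝ] Euc d)‖ ≤ τ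

/-- `ρ` and the Euclidean metric are bi-Lipschitz equivalent on `X`. -/
def BiLipEquivOn (ρ : MetricSpace (Euc d)) (X : Set (Euc d)) : Prop :=
  ∃ a : ℝ, 1 ≤ a ∧ ∀ x ∈ X, ∀ y ∈ X, a⁻¹ * rdist ρ x y ≤ ‖x - y‖ ∧ ‖x - y‖ ≤ a * rdist ρ x y

/-- `φ` is a self-conformal IFS on `X`; `X₁` is the larger set to which its maps (here already
extended) are required to extend as `C¹` conformal maps that are contractive in the Euclidean
metric. -/
structure IsSelfConformal (φ : Fin m → Euc d → Euc d) (X X₁ : Set (Euc d)) : Prop where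
  mifs : (MapSeq.const φ).IsMIFS X (eucMetric d)
  subset_interior : X ⊆ interior X₁
  contracts : (MapSeq.const φ).ContractsOn X₁ (eucMetric d)
  contDiffOn : ∀ j, ContDiffOn ℝ 1 (φ j) (interior X₁)
  conformal : ∀ j, ∀ x ∈ interior X₁, ConformalAt (φ j) x

/-- Bounded distortion property: `|φ_J'(x)| ≤ C |φ_J'(y)|` for all words `J` and all `x, y` in the
interior of `X₁`. -/
def BDP (φ : Fin m → Euc d → Euc d) (X₁ : Set (Euc d)) : Prop :=
  ∃ C : ℝ, ∀ J : Word (MapSeq.const φ).N, ∀ x ∈ interior X₁, ∀ y ∈ interior X₁,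
    ‖fderiv ℝ ((MapSeq.const φ).wordMap J) x‖ ≤ C * ‖fderiv ℝ ((MapSeq.const φ).wordMap J) y‖

end IFS

end

/-! Both cases reduce to volume counting in one abstract system, `ScaledIFS`. Each word J has a size
s(J), quasi-multiplicative under concatenation; φ_J scales volume by at least a multiple of s(J)^d,
and all images φ_J(X) of size comparable to φ_I(X) that meet it lie in a set of volume at most a
multiple of s(I)^d. In the affine case s(J) = |det A_J⁻¹|^(1/d), and the region is an ellipsoid
controlled by the homogeneity condition. In the conformal case s(J) = |φ_J'(p)| for a fixed p in X,
and bounded distortion makes the region a ball. `exists_card_bound` then bounds every family of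
comparable neighbours whose images overlap boundedly. Both settings need X of positive volume, which
each open set or weak separation condition supplies.

For MOSC ⇒ OSC (`osc_of_mosc`), let G be the interior of X. Prefix-free families of words comparable
to I whose images of G meet φ_I(G) are bounded in number, because the MOSC sets have disjoint images
under them. Choose I with a largest such family. If φ_{iWI}(G) met some φ_{jJ}(G) of no larger size
with i ≠ j, cutting jJ back to comparable size would give a neighbour of iWI outside the family
prefixed by iW, contradicting maximality. Hence the union of all φ_{WI}(G) is an OSC set.

For weak separation, each version implies `BoundedOverlap`, which counting upgrades to a bound on
the maps φ_J with φ_J(X) meeting φ_I(X), so that X itself serves as test set. The conformal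
conditions use the same sets of words. In the affine case Γ_b and 𝓘_b differ, and the bridge is
`BoundedComparable`, which mentions sizes only: comparable words are pushed into a common Γ_b or 𝓘_b
by appending one of finitely many words, and affine rigidity keeps distinct maps distinct.

Strong separation follows from invariance and injectivity: the limit set is an attractor contained
in every attractor, and words of equal length are not prefixes of one another. -/

noncomputable section

/-! ### Words as lists, composition, and disjointness of images. -/

section Words

variable {d m : ℕ}

/-- `φ_J = φ_{j_1} ∘ ⋯ ∘ φ_{j_k}` for a word `J = j_1 ⋯ j_k` given as a list of letters. -/
def listMap (φ : Fin m → Euc d → Euc d) : List (Fin m) → Euc d → Euc d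
  | [] => id
  | j :: J => φ j ∘ listMap φ J

/-- The list of letters of a word. -/
def letters (J : Word (fun _ => m)) : List (Fin m) := List.ofFn J.2

@[simp] theorem listMap_nil (φ : Fin m → Euc d → Euc d) : listMap φ [] = id := rfl

@[simp] theorem listMap_cons (φ : Fin m → Euc d → Euc d) (j : Fin m) (J : List (Fin m)) :
    listMap φ (j :: J) = φ j ∘ listMap φ J := rfl

theorem listMap_append (φ : Fin m → Euc d → Euc d) (I J : List (Fin m)) :
    listMap φ (I ++ J) = listMap φ I ∘ listMap φ J := by
  induction I with
  | nil => rfl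
  | cons i I ih => simp [ih, Function.comp_assoc]

theorem comp_const (φ : Fin m → Euc d → Euc d) (k : ℕ) (w : Fin k → Fin m) :
    (MapSeq.const φ).comp k w = listMap φ (List.ofFn w) := by
  induction k with
  | zero => simp [MapSeq.comp]
  | succ k ih =>
    rw [List.ofFn_succ_last, listMap_append, ← ih]
    rfl

theorem wordMap_const (φ : Fin m → Euc d → Euc d) (J : Word (MapSeq.const φ).N) :
    (MapSeq.const φ).wordMap J = listMap φ (letters J) := comp_const φ J.1 J.2

theorem letters_dropLast (J : Word (fun _ => m)) :
    letters J.dropLast = (letters J).dropLast := by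
  obtain ⟨k, w⟩ := J
  cases k with
  | zero => simp [letters, Word.dropLast]
  | succ k =>
    simp only [letters, Word.dropLast]
    rw [List.ofFn_succ_last, List.dropLast_concat]

/-- The word with a given list of letters. -/
def ofLetters (J : List (Fin m)) : Word (fun _ => m) := ⟨J.length, J.get⟩

@[simp] theorem letters_ofLetters (J : List (Fin m)) : letters (ofLetters J) = J := by
  simp [letters, ofLetters]

variable {φ : Fin m → Euc d → Euc d} {X : Set (Euc d)}

theorem mapsTo_listMap (h : ∀ j, MapsTo (φ j) X X) (J : List (Fin m)) :
    MapsTo (listMap φ J) X X := by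
  induction J with
  | nil => exact mapsTo_id X
  | cons j J ih => exact (h j).comp ih

theorem injOn_listMap (h : ∀ j, MapsTo (φ j) X X) (hi : ∀ j, InjOn (φ j) X) (J : List (Fin m)) :
    InjOn (listMap φ J) X := by
  induction J with
  | nil => exact injOn_id X
  | cons j J ih => exact (hi j).comp ih (mapsTo_listMap h J)

theorem continuousOn_listMap (h : ∀ j, MapsTo (φ j) X X) (hc : ∀ j, ContinuousOn (φ j) X)
    (J : List (Fin m)) : ContinuousOn (listMap φ J) X := by
  induction J with
  | nil => exact continuousOn_id
  | cons j J ih => exact (hc j).comp ih (mapsTo_listMap h J)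

theorem image_listMap_append_subset (h : ∀ j, MapsTo (φ j) X X) (I J : List (Fin m)) :
    listMap φ (I ++ J) '' X ⊆ listMap φ I '' X := by
  rw [listMap_append, image_comp]
  exact image_mono (mapsTo_listMap h J).image_subset

theorem disjoint_image_of_injOn {f : Euc d → Euc d} {S T : Set (Euc d)} (hf : InjOn f X)
    (hS : S ⊆ X) (hT : T ⊆ X) (h : Disjoint S T) : Disjoint (f '' S) (f '' T) := by
  rw [Set.disjoint_left]
  rintro _ ⟨x, hx, rfl⟩ ⟨y, hy, hxy⟩
  exact Set.disjoint_left.1 h hx (hf (hT hy) (hS hx) hxy ▸ hy)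

/-- Words neither of which is a prefix of the other have disjoint images of the sets of a nested
sequence. -/
theorem disjoint_image_of_not_prefix (hi : ∀ j, InjOn (φ j) X)
    (I J : List (Fin m)) (hIJ : ¬ I <+: J) (hJI : ¬ J <+: I) (V : ℕ → Set (Euc d))
    (hV : ∀ n, V n ⊆ X) (hsub : ∀ n j, φ j '' V (n + 1) ⊆ V n)
    (hdis : ∀ n i j, i ≠ j → Disjoint (φ i '' V (n + 1)) (φ j '' V (n + 1))) :
    Disjoint (listMap φ I '' V I.length) (listMap φ J '' V J.length) := by
  -- Quantified over all sequences V, since removing a first letter shifts the sequence by one.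
  have key : ∀ (I : List (Fin m)) (V : ℕ → Set (Euc d)), (∀ n j, φ j '' V (n + 1) ⊆ V n) →
      listMap φ I '' V I.length ⊆ V 0 := by
    intro I
    induction I with
    | nil => intro V _; simp
    | cons i I ih =>
      intro V hV
      rw [listMap_cons, image_comp]
      exact (image_mono (ih (fun n => V (n + 1)) fun n j => hV (n + 1) j)).trans (hV 0 i)
  induction I generalizing J V with
  | nil => exact absurd J.nil_prefix hIJ
  | cons i I ih =>
    cases J with
    | nil => exact absurd (List.nil_prefix) hJI
    | cons j J =>
      have hI := key I (fun n => V (n + 1)) fun n j => hsub (n + 1) j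
      have hJ := key J (fun n => V (n + 1)) fun n j => hsub (n + 1) j
      simp only [listMap_cons, image_comp, List.length_cons]
      -- A common first letter is removed by injectivity; at the first differing letter the
      -- level-wise disjointness applies.
      by_cases hij : i = j
      · subst hij
        refine disjoint_image_of_injOn (hi i) (hI.trans (hV 1)) (hJ.trans (hV 1)) ?_
        exact ih J (fun hp => hIJ (List.cons_prefix_cons.2 ⟨rfl, hp⟩))
          (fun hp => hJI (List.cons_prefix_cons.2 ⟨rfl, hp⟩)) (fun n => V (n + 1))
          (fun n => hV (n + 1)) (fun n => hsub (n + 1)) (fun n => hdis (n + 1))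
      · exact (hdis 0 i j hij).mono (image_mono hI) (image_mono hJ)

end Words

/-! ### The limit set as attractor, and strong separation. -/

section LimitSet

variable {d m : ℕ} {φ : Fin m → Euc d → Euc d} {X : Set (Euc d)}

/-- The images of `X` under the maps `φ_J` shrink geometrically in the length of `J`. -/
def ShrinksOn (φ : Fin m → Euc d → Euc d) (X : Set (Euc d)) : Prop :=
  ∃ C c : ℝ, 0 ≤ C ∧ 0 < c ∧ c < 1 ∧ ∀ J : List (Fin m), ∀ x ∈ X, ∀ y ∈ X,
    dist (listMap φ J x) (listMap φ J y) ≤ C * c ^ J.length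

/-- The list of the first `k` letters of an infinite word. -/
def initial (j : ℕ → Fin m) (k : ℕ) : List (Fin m) := List.ofFn fun i : Fin k => j i

theorem length_initial (j : ℕ → Fin m) (k : ℕ) : (initial j k).length = k := by simp [initial]

theorem initial_succ (j : ℕ → Fin m) (k : ℕ) : initial j (k + 1) = initial j k ++ [j k] := by
  simp only [initial]
  rw [List.ofFn_succ_last]
  rfl

theorem initial_succ' (j : ℕ → Fin m) (k : ℕ) :
    initial j (k + 1) = j 0 :: initial (fun n => j (n + 1)) k := by
  simp [initial, List.ofFn_succ]

theorem mem_limitSet_const {z : Euc d} : z ∈ (MapSeq.const φ).limitSet X ↔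
    ∃ j : ℕ → Fin m, ∀ a ∈ X, Tendsto (fun k => listMap φ (initial j k) a) atTop (𝓝 z) := by
  simp only [MapSeq.limitSet, initial, mem_ofPred_eq]
  refine exists_congr fun j => forall₂_congr fun a _ => ?_
  have : (fun k => (MapSeq.const φ).comp k (fun i => j i) a) =
      fun k => listMap φ (List.ofFn fun i : Fin k => j i) a := by
    funext k
    exact congrFun (comp_const φ k _) a
  exact iff_of_eq (congrArg (fun u => Tendsto u atTop (𝓝 z)) this)

/-- Consecutive approximants are images of two points of X under the same prefix map, so they form a
geometric Cauchy sequence. The rate does not depend on the infinite word, which later makes the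
coding map continuous. -/
theorem exists_coding (hX : X.Nonempty) (h : ∀ j, MapsTo (φ j) X X) (hs : ShrinksOn φ X) :
    ∃ (π : (ℕ → Fin m) → Euc d) (C c : ℝ), 0 < c ∧ c < 1 ∧ ∀ j, ∀ a ∈ X,
      Tendsto (fun k => listMap φ (initial j k) a) atTop (𝓝 (π j)) ∧
      ∀ k, dist (listMap φ (initial j k) a) (π j) ≤ C * c ^ k / (1 - c) := by
  obtain ⟨C, c, hC, hc0, hc1, hs⟩ := hs
  obtain ⟨a₀, ha₀⟩ := hX
  have step : ∀ j : ℕ → Fin m, ∀ a ∈ X, ∀ k, dist (listMap φ (initial j k) a)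
      (listMap φ (initial j (k + 1)) a) ≤ C * c ^ k := by
    intro j a ha k
    have := hs (initial j k) a ha (φ (j k) a) (h _ ha)
    rw [length_initial] at this
    rwa [initial_succ, listMap_append]
  have lim : ∀ j : ℕ → Fin m, ∃ z,
      Tendsto (fun k => listMap φ (initial j k) a₀) atTop (𝓝 z) := fun j =>
    cauchySeq_tendsto_of_complete (cauchySeq_of_le_geometric c C hc1 (step j a₀ ha₀))
  choose π hπ using lim
  refine ⟨π, C, c, hc0, hc1, fun j a ha => ?_⟩
  have ht : Tendsto (fun k => listMap φ (initial j k) a) atTop (𝓝 (π j)) := by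
    refine tendsto_of_tendsto_of_dist (hπ j) ?_
    refine squeeze_zero (fun _ => dist_nonneg)
      (fun k => (hs (initial j k) a₀ ha₀ a ha).trans_eq (by rw [length_initial])) ?_
    simpa using (tendsto_pow_atTop_nhds_zero_of_lt_one hc0.le hc1).const_mul C
  exact ⟨ht, dist_le_of_le_geometric_of_tendsto c C hc1 (step j a ha) ht⟩

/-- The limit set is the range of a continuous coding map on a compact product space; shifting a
word and prepending a letter give the two inclusions of the invariance equation. -/
theorem isAttractor_limitSet (hX : X.Nonempty) (hXc : IsCompact X) (h : ∀ j, MapsTo (φ j) X X)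
    (hc : ∀ j, ContinuousOn (φ j) X) (hs : ShrinksOn φ X) (hm : 0 < m) :
    IsAttractor φ X ((MapSeq.const φ).limitSet X) := by
  obtain ⟨π, C, c, hc0, hc1, hπ⟩ := exists_coding hX h hs
  obtain ⟨a, ha⟩ := hX
  have hrange : (MapSeq.const φ).limitSet X = range π := by
    ext z
    rw [mem_limitSet_const]
    constructor
    · rintro ⟨j, hj⟩
      exact ⟨j, tendsto_nhds_unique (hπ j a ha).1 (hj a ha)⟩
    · rintro ⟨j, rfl⟩
      exact ⟨j, fun b hb => (hπ j b hb).1⟩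
  have hmem : ∀ j, π j ∈ X := fun j =>
    hXc.isClosed.mem_of_tendsto (hπ j a ha).1
      (Eventually.of_forall fun k => mapsTo_listMap h _ ha)
  have hcont : Continuous π := by
    rw [continuous_iff_continuousAt]
    intro j
    rw [ContinuousAt, Metric.tendsto_nhds]
    intro ε hε
    have ht : Tendsto (fun k => C * c ^ k / (1 - c) + C * c ^ k / (1 - c)) atTop (𝓝 0) := by
      have := ((tendsto_pow_atTop_nhds_zero_of_lt_one hc0.le hc1).const_mul C).div_const (1 - c)
      simpa using this.add this
    obtain ⟨k, hk⟩ := (ht.eventually_lt_const hε).exists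
    have hev : ∀ᶠ j' in 𝓝 j, ∀ i ∈ Finset.range k, j' i = j i := by
      rw [Filter.eventually_all_finset]
      intro i _
      exact (continuous_apply i).continuousAt.eventually
        ((isOpen_discrete {j i}).eventually_mem (mem_singleton _))
    filter_upwards [hev] with j' hj'
    have heq : initial j' k = initial j k := by
      simp only [initial]
      congr 1
      funext i
      exact hj' i (Finset.mem_range.2 i.2)
    have h1 := (hπ j a ha).2 k
    have h2 := (hπ j' a ha).2 k
    rw [heq] at h2
    calc dist (π j') (π j) ≤ dist (listMap φ (initial j k) a) (π j') +
          dist (listMap φ (initial j k) a) (π j) := dist_triangle_left _ _ _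
      _ ≤ _ := add_le_add h2 h1
      _ < ε := hk
  have hshift : ∀ j : ℕ → Fin m, π j = φ (j 0) (π fun n => j (n + 1)) := by
    intro j
    have h1 := ((tendsto_add_atTop_iff_nat 1).2 (hπ j a ha).1)
    refine tendsto_nhds_unique h1 ?_
    have h2 : Tendsto (fun k => listMap φ (initial (fun n => j (n + 1)) k) a) atTop
        (𝓝[X] (π fun n => j (n + 1))) :=
      tendsto_nhdsWithin_iff.2 ⟨(hπ _ a ha).1, Eventually.of_forall fun k => mapsTo_listMap h _ ha⟩
    have h3 := Tendsto.comp (hc (j 0) _ (hmem fun n => j (n + 1))) h2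
    refine h3.congr fun k => ?_
    rw [initial_succ']
    rfl
  rw [hrange]
  refine ⟨?_, ⟨_, ⟨fun _ => ⟨0, hm⟩, rfl⟩⟩, isCompact_range hcont, ?_⟩
  · rintro _ ⟨j, rfl⟩
    exact hmem j
  · ext z
    simp only [mem_iUnion]
    constructor
    · rintro ⟨j, rfl⟩
      exact ⟨j 0, _, ⟨_, rfl⟩, (hshift j).symm⟩
    · rintro ⟨i, _, ⟨j, rfl⟩, rfl⟩
      exact ⟨fun n => Nat.casesOn n i j, hshift _⟩

/-- An orbit started inside K stays in K, which is closed. This inclusion is enough for strong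
separation; uniqueness of the attractor is not needed. -/
theorem limitSet_subset_of_isAttractor {K : Set (Euc d)} (hK : IsAttractor φ X K) :
    (MapSeq.const φ).limitSet X ⊆ K := by
  intro z hz
  obtain ⟨j, hj⟩ := mem_limitSet_const.1 hz
  obtain ⟨hKX, ⟨a, ha⟩, hKc, hKeq⟩ := hK
  refine hKc.isClosed.mem_of_tendsto (hj a (hKX ha)) (Eventually.of_forall fun k => ?_)
  refine mapsTo_listMap (fun i x hx => ?_) _ ha
  rw [hKeq]
  exact mem_iUnion.2 ⟨i, x, hx, rfl⟩

theorem mssc_iff_ssc (hX : X.Nonempty) (hXc : IsCompact X) (h : ∀ j, MapsTo (φ j) X X)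
    (hi : ∀ j, InjOn (φ j) X) (hc : ∀ j, ContinuousOn (φ j) X) (hs : ShrinksOn φ X) (hm : 0 < m) :
    (MapSeq.const φ).MSSC X ↔ SSC φ X := by
  constructor
  · intro hM
    refine ⟨_, isAttractor_limitSet hX hXc h hc hs hm, fun i j hij => ?_⟩
    have := hM 1 one_pos (fun _ => j) (fun _ => i) fun he => hij (congrFun he 0).symm
    have hone : ∀ i : Fin m, (MapSeq.const φ).comp 1 (fun _ => i) = φ i := fun i => rfl
    rw [hone, hone] at this
    exact this
  · rintro ⟨K, hK, hdis⟩ n hn I J hIJ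
    have hsub : (MapSeq.const φ).attractor X n ⊆ K := limitSet_subset_of_isAttractor hK
    have hKj : ∀ j, φ j '' K ⊆ K := fun j => by
      conv_rhs => rw [hK.2.2.2]
      exact subset_iUnion (fun j => φ j '' K) j
    have hne : ∀ I J : Fin n → Fin m, I ≠ J → ¬ List.ofFn I <+: List.ofFn J := by
      intro I J hIJ hp
      exact hIJ (List.ofFn_injective (hp.eq_of_length (by simp)))
    have := disjoint_image_of_not_prefix hi _ _ (hne J I hIJ.symm) (hne I J hIJ) (fun _ => K)
      (fun _ => hK.1) (fun _ => hKj) (fun _ => hdis)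
    have e1 : (MapSeq.const φ).comp n I = _ := comp_const φ n I
    have e2 : (MapSeq.const φ).comp n J = _ := comp_const φ n J
    rw [e1, e2]
    exact this.mono (image_mono hsub) (image_mono hsub)

end LimitSet

/-! ### Volume counting in abstract scaled systems, and MOSC ⇒ OSC. -/

section Scaled

variable {d m : ℕ}

theorem exists_pos_le_of_finite {α : Type*} [Finite α] (f : α → ℝ) (hf : ∀ a, 0 < f a) :
    ∃ c > 0, ∀ a, c ≤ f a := by
  rcases isEmpty_or_nonempty α with h | h
  · exact ⟨1, one_pos, fun a => isEmptyElim a⟩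
  · obtain ⟨a, ha⟩ := Finite.exists_min f
    exact ⟨f a, hf a, ha⟩

open Classical in
/-- A finite family of subsets of `B` of measure at least `a`, no more than `γ` of which have a
common point, has at most `γ * volume B / a` members. -/
theorem card_mul_le_of_multiplicity {ι : Type*} (S : Finset ι) (E : ι → Set (Euc d))
    (B : Set (Euc d)) (a : ENNReal) (γ : ℕ) (hE : ∀ i ∈ S, MeasurableSet (E i))
    (hB : ∀ i ∈ S, E i ⊆ B) (ha : ∀ i ∈ S, a ≤ volume (E i))
    (hγ : ∀ x, (S.filter fun i => x ∈ E i).card ≤ γ) : S.card * a ≤ γ * volume B := by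
  calc (S.card : ENNReal) * a = ∑ i ∈ S, a := by simp
    _ ≤ ∑ i ∈ S, volume (E i) := Finset.sum_le_sum ha
    _ = ∑ i ∈ S, ∫⁻ x, (E i).indicator 1 x := by
        refine Finset.sum_congr rfl fun i hi => ?_
        rw [lintegral_indicator_one (hE i hi)]
    _ = ∫⁻ x, ∑ i ∈ S, (E i).indicator 1 x := by
        rw [lintegral_finsetSum]
        exact fun i hi => measurable_one.indicator (hE i hi)
    -- B need not be measurable, so a measurable hull of the same volume takes its place.
    _ ≤ ∫⁻ x, (toMeasurable volume B).indicator (fun _ => (γ : ENNReal)) x := by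
        refine lintegral_mono fun x => ?_
        by_cases hx : x ∈ toMeasurable volume B
        · rw [indicator_of_mem hx]
          have : ∑ i ∈ S, (E i).indicator (1 : Euc d → ENNReal) x =
              ((S.filter fun i => x ∈ E i).card : ENNReal) := by
            simp [indicator_apply]
          rw [this]
          exact Nat.cast_le.2 (hγ x)
        · rw [indicator_of_notMem hx]
          refine (Finset.sum_eq_zero fun i hi => ?_).le
          exact indicator_of_notMem (fun h => hx (subset_toMeasurable _ _ (hB i hi h))) _
    _ = γ * volume B := by
        rw [lintegral_indicator_const (measurableSet_toMeasurable _ _), measure_toMeasurable]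

/-- An iterated function system together with a size `s J` of each of its words, such that sizes
are multiplicative up to a constant, `φ_J` scales volumes at least by a multiple of `(s J) ^ d`,
and the images of `X` of comparable size that meet a given one lie in a set of comparable volume. -/
structure ScaledIFS (φ : Fin m → Euc d → Euc d) (X : Set (Euc d)) (s : List (Fin m) → ℝ) :
    Prop where
  isCompact : IsCompact X
  mapsTo : ∀ j, MapsTo (φ j) X X
  injOn : ∀ j, InjOn (φ j) X
  continuousOn : ∀ j, ContinuousOn (φ j) X
  isOpen_image : ∀ j, ∀ V ⊆ X, IsOpen V → IsOpen (φ j '' V)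
  pos : ∀ J, 0 < s J
  bounded : ∃ b, ∀ J, s J ≤ b
  quasiMul : ∃ C, 1 ≤ C ∧ ∀ I J, s (I ++ J) ≤ C * (s I * s J) ∧ s I * s J ≤ C * s (I ++ J)
  volume_image : ∃ c > 0, ∀ J, ∀ U ⊆ X, MeasurableSet U →
    ENNReal.ofReal (c * s J ^ d) * volume U ≤ volume (listMap φ J '' U)
  region : ∀ κ > 0, ∃ M, 0 ≤ M ∧ ∀ I, ∃ B, volume B ≤ ENNReal.ofReal (M * s I ^ d) ∧
    ∀ J, κ * s I ≤ s J → κ * s J ≤ s I →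
      (listMap φ J '' X ∩ listMap φ I '' X).Nonempty → listMap φ J '' X ⊆ B

namespace ScaledIFS

variable {φ : Fin m → Euc d → Euc d} {X : Set (Euc d)} {s : List (Fin m) → ℝ}

-- Each image has volume at least c(κr)^d δ, they lie in a set of volume at most M r^d, and no point
-- is covered more than γ times. The factor r^d cancels, so the bound is independent of scale.
open Classical in
theorem exists_card_bound (h : ScaledIFS φ X s) {M κ δ : ℝ} (hM : 0 ≤ M) (hκ : 0 < κ) (hδ : 0 < δ)
    (γ : ℕ) : ∃ N : ℕ, ∀ {ι : Type} (S : Finset ι) (w : ι → List (Fin m)) (U : ι → Set (Euc d))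
      (r : ℝ) (B : Set (Euc d)), 0 < r → volume B ≤ ENNReal.ofReal (M * r ^ d) →
      (∀ i ∈ S, U i ⊆ X ∧ NullMeasurableSet (U i) volume ∧ ENNReal.ofReal δ ≤ volume (U i)) →
      (∀ i ∈ S, κ * r ≤ s (w i)) → (∀ i ∈ S, listMap φ (w i) '' U i ⊆ B) →
      (∀ x, (S.filter fun i => x ∈ listMap φ (w i) '' U i).card ≤ γ) → S.card ≤ N := by
  obtain ⟨c, hc, hvol⟩ := h.volume_image
  refine ⟨⌈γ * M / (c * κ ^ d * δ)⌉₊, fun {ι} S w U r B hr hB hU hs hUB hγ => ?_⟩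
  -- Passing to a measurable subset of full measure makes the images measurable, the maps being
  -- injective and continuous on X.
  have hex : ∀ i, ∃ T, i ∈ S → T ⊆ U i ∧ MeasurableSet T ∧ ENNReal.ofReal δ ≤ volume T := by
    intro i
    by_cases hi : i ∈ S
    · obtain ⟨T, hT, hTm, hTe⟩ := (hU i hi).2.1.exists_measurable_subset_ae_eq
      exact ⟨T, fun _ => ⟨hT, hTm, (hU i hi).2.2.trans_eq (measure_congr hTe).symm⟩⟩
    · exact ⟨∅, fun h => absurd h hi⟩
  choose T hT using hex
  have hTX : ∀ i ∈ S, T i ⊆ X := fun i hi => (hT i hi).1.trans (hU i hi).1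
  have hcount := card_mul_le_of_multiplicity S (fun i => listMap φ (w i) '' T i) B
    (ENNReal.ofReal (c * (κ * r) ^ d * δ)) γ
    (fun i hi => (hT i hi).2.1.image_of_continuousOn_injOn
      ((continuousOn_listMap h.mapsTo h.continuousOn _).mono (hTX i hi))
      ((injOn_listMap h.mapsTo h.injOn _).mono (hTX i hi)))
    (fun i hi => (image_mono (hT i hi).1).trans (hUB i hi))
    (fun i hi => by
      refine le_trans ?_ (hvol (w i) (T i) (hTX i hi) (hT i hi).2.1)
      rw [ENNReal.ofReal_mul (by positivity)]
      refine mul_le_mul' (ENNReal.ofReal_le_ofReal ?_) (hT i hi).2.2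
      have := hs i hi
      gcongr)
    (fun x => (Finset.card_le_card (fun i hi => by
      rw [Finset.mem_filter] at hi ⊢
      exact ⟨hi.1, image_mono (hT i hi.1).1 hi.2⟩)).trans (hγ x))
  have h2 : ENNReal.ofReal (S.card * (c * (κ * r) ^ d * δ)) ≤ ENNReal.ofReal (γ * (M * r ^ d)) := by
    rw [ENNReal.ofReal_mul (p := (S.card : ℝ)) (by positivity),
      ENNReal.ofReal_mul (p := (γ : ℝ)) (by positivity), ENNReal.ofReal_natCast,
      ENNReal.ofReal_natCast]
    exact hcount.trans (by gcongr)
  rw [ENNReal.ofReal_le_ofReal_iff (by positivity)] at h2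
  have h3 : (S.card : ℝ) ≤ γ * M / (c * κ ^ d * δ) := by
    rw [le_div_iff₀ (by positivity)]
    have hrd : 0 < r ^ d := by positivity
    refine le_of_mul_le_mul_right ?_ hrd
    calc (S.card : ℝ) * (c * κ ^ d * δ) * r ^ d = S.card * (c * (κ * r) ^ d * δ) := by
          rw [mul_pow]; ring
      _ ≤ _ := h2
      _ = _ := by ring
  exact_mod_cast h3.trans (Nat.le_ceil _)

theorem exists_letter_lower (h : ScaledIFS φ X s) :
    ∃ η > 0, ∀ J k, η * s J ≤ s (J ++ [k]) := by
  obtain ⟨C, hC, hmul⟩ := h.quasiMul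
  obtain ⟨c, hc, hck⟩ := exists_pos_le_of_finite (fun k : Fin m => s [k]) fun k => h.pos _
  refine ⟨c / C, by positivity, fun J k => ?_⟩
  rw [div_mul_eq_mul_div, div_le_iff₀ (by positivity)]
  nlinarith [(hmul J [k]).2, hck k, h.pos J]

/-- A nonempty word of size at most `s I` has a nonempty prefix of size comparable to `s I`. -/
theorem exists_prefix (h : ScaledIFS φ X s) : ∃ η > 0, ∀ I j J, s (j :: J) ≤ s I →
    ∃ P R, J = P ++ R ∧ η * s I ≤ s (j :: P) ∧ s (j :: P) ≤ s I := by
  obtain ⟨η, hη, hlow⟩ := h.exists_letter_lower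
  obtain ⟨b, hb⟩ := h.bounded
  have hb0 : 0 < b := (h.pos []).trans_le (hb [])
  obtain ⟨c, hc, hck⟩ := exists_pos_le_of_finite (fun k : Fin m => s [k]) fun k => h.pos _
  -- η handles a prefix just after its size drops below s(I); c / b handles a single letter that is
  -- already small enough. The first letter is always kept, as `osc_of_mosc` must distinguish words
  -- by it.
  refine ⟨min η (c / b), by positivity, fun I j J => ?_⟩
  induction J using List.reverseRecOn with
  | nil =>
    intro hJ
    refine ⟨[], [], rfl, ?_, hJ⟩
    calc min η (c / b) * s I ≤ c / b * b :=
          mul_le_mul (min_le_right _ _) (hb I) (h.pos I).le (by positivity)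
      _ = c := by field_simp
      _ ≤ _ := hck j
  | append_singleton J k ih =>
    intro hJ
    by_cases hle : s (j :: J) ≤ s I
    · obtain ⟨P, R, rfl, h1, h2⟩ := ih hle
      exact ⟨P, R ++ [k], by simp, h1, h2⟩
    · refine ⟨J ++ [k], [], by simp, ?_, hJ⟩
      calc min η (c / b) * s I ≤ η * s (j :: J) :=
            mul_le_mul (min_le_left _ _) (not_le.1 hle).le (h.pos I).le hη.le
        _ ≤ _ := hlow (j :: J) k

theorem isOpen_image_listMap (h : ScaledIFS φ X s) (J : List (Fin m)) {V : Set (Euc d)}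
    (hV : IsOpen V) (hVX : V ⊆ X) : IsOpen (listMap φ J '' V) := by
  induction J with
  | nil => simpa using hV
  | cons j J ih =>
    rw [listMap_cons, image_comp]
    exact h.isOpen_image j _
      ((image_mono hVX).trans (mapsTo_listMap h.mapsTo J).image_subset) ih

theorem mapsTo_interior (h : ScaledIFS φ X s) (j : Fin m) :
    MapsTo (φ j) (interior X) (interior X) := by
  rw [mapsTo_iff_image_subset]
  exact interior_maximal ((image_mono interior_subset).trans (h.mapsTo j).image_subset)
    (h.isOpen_image j _ interior_subset isOpen_interior)

open Classical in
/-- The Moran-type open set condition gives the open set condition: an image of the interior of `X`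
whose neighbours of comparable size are maximal in number has no further neighbours after
composition with any `φ_W`. -/
theorem osc_of_mosc (h : ScaledIFS φ X s) (hM : (MapSeq.const φ).MOSC X) : OSC φ X := by
  obtain ⟨V, hV, hVsub, hVdis, hVpos⟩ := hM
  obtain ⟨δ, hδ0, hδ⟩ := ENNReal.lt_iff_exists_real_btwn.1 hVpos
  have hδpos : 0 < δ := by
    rcases lt_or_ge 0 δ with h0 | h0
    · exact h0
    · simp [ENNReal.ofReal_of_nonpos h0] at hδ
  obtain ⟨C, hC, hmul⟩ := h.quasiMul
  obtain ⟨η, hη, hpre⟩ := h.exists_prefix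
  -- Prefixing both of two words costs one factor C for each, hence C²; with this κ the new
  -- neighbour remains comparable under every prefix.
  set κ := min η 1 / C ^ 2 with hκdef
  have hκ : 0 < κ := by positivity
  have hκη : κ * C ^ 2 ≤ η := by
    rw [hκdef, div_mul_cancel₀ _ (by positivity)]
    exact min_le_left _ _
  have hκ1 : κ * C ^ 2 ≤ 1 := by
    rw [hκdef, div_mul_cancel₀ _ (by positivity)]
    exact min_le_right _ _
  set G := interior X
  have hGX : G ⊆ X := interior_subset
  have hG : G.Nonempty := by
    have hne : (V 0).Nonempty := by
      apply nonempty_of_measure_ne_zero (μ := volume)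
      exact (hVpos.trans_le (iInf_le _ 0)).ne'
    exact hne.mono (interior_maximal (hV 0).2 (hV 0).1)
  obtain ⟨M, hM0, hreg⟩ := h.region κ hκ
  obtain ⟨N, hN⟩ := h.exists_card_bound hM0 hκ hδpos 1
  -- Comparability is required under every prefix W, so that prefixing a whole admissible family
  -- leaves κ unchanged; iterated quasi-multiplicativity would degrade it.
  let Adm : List (Fin m) → Finset (List (Fin m)) → Prop := fun I F =>
    (∀ J ∈ F, (∀ W, κ * s (W ++ I) ≤ s (W ++ J) ∧ κ * s (W ++ J) ≤ s (W ++ I)) ∧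
      (listMap φ J '' G ∩ listMap φ I '' G).Nonempty) ∧
    ∀ J ∈ F, ∀ J' ∈ F, J ≠ J' → ¬ J <+: J'
  have hbound : ∀ I F, Adm I F → F.card ≤ N := by
    rintro I F ⟨hF, hanti⟩
    obtain ⟨B, hB, hreg⟩ := hreg I
    refine hN F id (fun J => V J.length) (s I) B (h.pos I) hB
      (fun J _ => ⟨(hV _).2, (hV _).1.measurableSet.nullMeasurableSet,
        hδ.2.le.trans (iInf_le _ _)⟩) (fun J hJ => ((hF J hJ).1 []).1)
      (fun J hJ => (image_mono (hV _).2).trans (hreg J ((hF J hJ).1 []).1 ((hF J hJ).1 []).2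
        ((hF J hJ).2.mono (inter_subset_inter (image_mono hGX) (image_mono hGX))))) fun x => ?_
    rw [Finset.card_le_one]
    intro J hJ J' hJ'
    rw [Finset.mem_filter] at hJ hJ'
    by_contra hne
    exact Set.disjoint_left.1 (disjoint_image_of_not_prefix h.injOn J J'
      (hanti J hJ.1 J' hJ'.1 hne) (hanti J' hJ'.1 J hJ.1 (Ne.symm hne)) V (fun n => (hV n).2)
      hVsub hVdis) hJ.2 hJ'.2
  have hmax : ∃ I F, Adm I F ∧ ∀ I' F', Adm I' F' → F'.card ≤ F.card := by
    let T : Set ℕ := {n | ∃ I F, Adm I F ∧ F.card = n}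
    have hne : T.Nonempty := ⟨0, [], ∅, ⟨by simp, by simp⟩, rfl⟩
    have hbdd : BddAbove T := ⟨N, by rintro _ ⟨I, F, hIF, rfl⟩; exact hbound I F hIF⟩
    obtain ⟨I, F, hIF, hcard⟩ := Nat.sSup_mem hne hbdd
    exact ⟨I, F, hIF, fun I' F' h' => hcard ▸ le_csSup hbdd ⟨I', F', h', rfl⟩⟩
  obtain ⟨I, F, ⟨hF, hanti⟩, hmax⟩ := hmax
  -- If the images met, the comparable prefix j P of the smaller word could be added to the family
  -- prefixed by i W. Its different first letter makes it new and keeps the family prefix-free,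
  -- against maximality.
  have hclaim : ∀ i j W J, i ≠ j → s (j :: J) ≤ s (i :: (W ++ I)) →
      Disjoint (listMap φ (j :: J) '' G) (listMap φ (i :: (W ++ I)) '' G) := by
    intro i j W J hij hle
    obtain ⟨P, R, rfl, h1, h2⟩ := hpre _ j J hle
    have hsub : listMap φ (j :: (P ++ R)) '' G ⊆ listMap φ (j :: P) '' G := by
      rw [← List.cons_append, listMap_append, image_comp]
      exact image_mono (mapsTo_listMap h.mapsTo_interior R).image_subset
    refine Disjoint.mono_left hsub ?_
    rw [Set.disjoint_iff_inter_eq_empty, ← Set.not_nonempty_iff_eq_empty]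
    intro hmeet
    have hnotin : (j :: P) ∉ F.image fun J => i :: (W ++ J) := by
      rw [Finset.mem_image]
      rintro ⟨J, _, hJ⟩
      exact hij (List.cons.inj hJ).1
    have hadm : Adm (i :: (W ++ I)) (insert (j :: P) (F.image fun J => i :: (W ++ J))) := by
      constructor
      · intro J hJ
        rw [Finset.mem_insert, Finset.mem_image] at hJ
        rcases hJ with rfl | ⟨J, hJ, rfl⟩
        · refine ⟨fun Z => ?_, hmeet⟩
          have a1 := hmul Z (i :: (W ++ I))
          have a2 := hmul Z (j :: P)
          have hz := h.pos Z
          have hC0 : 0 < C := by positivity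
          have e1 : s Z * (η * s (i :: (W ++ I))) ≤ s Z * s (j :: P) := by gcongr
          have e2 : s Z * s (j :: P) ≤ s Z * s (i :: (W ++ I)) := by gcongr
          have hp1 := mul_pos hz (h.pos (i :: (W ++ I)))
          constructor
          · refine le_of_mul_le_mul_right ?_ hC0
            calc κ * s (Z ++ i :: (W ++ I)) * C ≤ κ * (C * (s Z * s (i :: (W ++ I)))) * C := by
                  gcongr; exact a1.1
              _ = (κ * C ^ 2) * (s Z * s (i :: (W ++ I))) := by ring
              _ ≤ η * (s Z * s (i :: (W ++ I))) := by gcongr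
              _ = s Z * (η * s (i :: (W ++ I))) := by ring
              _ ≤ s Z * s (j :: P) := e1
              _ ≤ C * s (Z ++ j :: P) := a2.2
              _ = _ := mul_comm _ _
          · refine le_of_mul_le_mul_right ?_ hC0
            calc κ * s (Z ++ j :: P) * C ≤ κ * (C * (s Z * s (j :: P))) * C := by
                  gcongr; exact a2.1
              _ ≤ κ * (C * (s Z * s (i :: (W ++ I)))) * C := by gcongr
              _ = (κ * C ^ 2) * (s Z * s (i :: (W ++ I))) := by ring
              _ ≤ 1 * (s Z * s (i :: (W ++ I))) := by gcongr
              _ ≤ C * s (Z ++ i :: (W ++ I)) := by rw [one_mul]; exact a1.2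
              _ = _ := mul_comm _ _
        · refine ⟨fun Z => ?_, ?_⟩
          · have := (hF J hJ).1 (Z ++ i :: W)
            simpa using this
          · obtain ⟨x, ⟨y, hy, hyx⟩, ⟨z, hz, hzx⟩⟩ := (hF J hJ).2
            rw [← List.cons_append, listMap_append, ← List.cons_append, listMap_append]
            exact ⟨listMap φ (i :: W) x, ⟨y, hy, by simp [← hyx]⟩, ⟨z, hz, by simp [← hzx]⟩⟩
      · intro J hJ J' hJ' hne
        rw [Finset.mem_insert, Finset.mem_image] at hJ hJ'
        rcases hJ with rfl | ⟨J, hJ, rfl⟩ <;> rcases hJ' with rfl | ⟨J', hJ', rfl⟩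
        · exact absurd rfl hne
        · exact fun hp => hij (List.cons_prefix_cons.1 hp).1.symm
        · exact fun hp => hij (List.cons_prefix_cons.1 hp).1
        · intro hp
          refine hanti J hJ J' hJ' (fun he => hne (by rw [he])) ?_
          exact (List.prefix_append_right_inj W).1 (List.cons_prefix_cons.1 hp).2
    have hcard := hmax _ _ hadm
    rw [Finset.card_insert_of_notMem hnotin, Finset.card_image_of_injective] at hcard
    · omega
    · intro J J' hJ
      simpa using hJ
  refine ⟨⋃ W, listMap φ (W ++ I) '' G, ?_, ?_, ?_, ?_, ?_⟩
  · exact isOpen_iUnion fun W => h.isOpen_image_listMap _ isOpen_interior hGX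
  · exact (hG.image (listMap φ ([] ++ I))).mono (subset_iUnion (fun W => listMap φ (W ++ I) '' G) [])
  · exact iUnion_subset fun W =>
      (image_mono hGX).trans (mapsTo_listMap h.mapsTo _).image_subset
  · intro j
    rw [image_iUnion]
    refine iUnion_subset fun W => ?_
    rw [← image_comp]
    exact subset_iUnion (fun W => listMap φ (W ++ I) '' G) (j :: W)
  · intro i j hij
    simp only [image_iUnion, disjoint_iUnion_left, disjoint_iUnion_right, ← image_comp]
    intro W W'
    -- The word of smaller size takes the role of j J in the claim.
    rcases le_total (s (j :: (W ++ I))) (s (i :: (W' ++ I))) with hle | hle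
    · exact (hclaim i j _ _ hij hle).symm
    · exact hclaim j i _ _ hij.symm hle

end ScaledIFS

theorem mosc_of_osc {φ : Fin m → Euc d → Euc d} {X : Set (Euc d)} (h : OSC φ X) :
    (MapSeq.const φ).MOSC X := by
  obtain ⟨V, hV, hne, hVX, hsub, hdis⟩ := h
  refine ⟨fun _ => V, fun _ => ⟨hV, hVX⟩, fun _ => hsub, fun _ => hdis, ?_⟩
  rw [iInf_const]
  exact hV.measure_pos _ hne

end Scaled

/-! ### Weak separation as bounded overlap, bounded neighbours and bounded comparable words. -/

section Overlaps

variable {d m : ℕ}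

theorem encard_le_of_forall_finset {α : Type*} {T : Set α} {N : ℕ}
    (h : ∀ S : Finset α, ↑S ⊆ T → S.card ≤ N) : T.encard ≤ N := by
  by_contra hlt
  obtain ⟨t, htT, ht⟩ := Set.exists_subset_encard_eq
    (show ((N + 1 : ℕ) : ℕ∞) ≤ T.encard from by
      exact_mod_cast Order.add_one_le_of_lt (not_le.1 hlt))
  have hfin : t.Finite := Set.finite_of_encard_eq_coe ht
  have := h hfin.toFinset (by simpa using htT)
  rw [hfin.encard_eq_coe_toFinset_card] at ht
  have ht' : hfin.toFinset.card = N + 1 := by exact_mod_cast ht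
  omega

/-- Sets of volume bounded away from zero whose images under the distinct maps `φ_J`, `J ∈ W b`,
cover no point more than a bounded number of times. -/
def BoundedOverlap (φ : Fin m → Euc d → Euc d) (X : Set (Euc d))
    (W : ℝ → Set (Word (MapSeq.const φ).N)) : Prop :=
  ∃ U : ℕ → Set (Euc d), (∀ n, U n ⊆ X ∧ NullMeasurableSet (U n) volume) ∧
    0 < ⨅ n, volume (U n) ∧
    ∃ γ : ℕ, ∀ b : ℝ, 0 < b → b < 1 → ∀ x ∈ X,
      {f : X → Euc d | ∃ J ∈ W b, f = X.domRestrict ((MapSeq.const φ).wordMap J) ∧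
        x ∈ (MapSeq.const φ).wordMap J '' U J.1}.encard ≤ γ

/-- The number of distinct maps `φ_J`, `J ∈ W b`, with `φ_J(X)` meeting `φ_I(X)`, is bounded for
`I ∈ W b`. -/
def BoundedNeighbours (φ : Fin m → Euc d → Euc d) (X : Set (Euc d))
    (W : ℝ → Set (Word (MapSeq.const φ).N)) : Prop :=
  ∃ γ : ℕ, ∀ b : ℝ, 0 < b → b < 1 → ∀ I ∈ W b,
    {f : X → Euc d | ∃ J ∈ W b, f = X.domRestrict ((MapSeq.const φ).wordMap J) ∧
      ((MapSeq.const φ).wordMap J '' X ∩ (MapSeq.const φ).wordMap I '' X).Nonempty}.encard ≤ γ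

variable {φ : Fin m → Euc d → Euc d} {X : Set (Euc d)} {W : ℝ → Set (Word (MapSeq.const φ).N)}

/-- If x lies in one image, every map whose image contains x is a neighbour of that one. -/
theorem encard_through_point_le {W₀ : Set (Word (MapSeq.const φ).N)} {U : ℕ → Set (Euc d)}
    {γ : ℕ} (h : ∀ I ∈ W₀,
      {f : X → Euc d | ∃ J ∈ W₀, f = X.domRestrict ((MapSeq.const φ).wordMap J) ∧
        ((MapSeq.const φ).wordMap J '' U J.1 ∩
          (MapSeq.const φ).wordMap I '' U I.1).Nonempty}.encard ≤ γ) (x : Euc d) :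
    {f : X → Euc d | ∃ J ∈ W₀, f = X.domRestrict ((MapSeq.const φ).wordMap J) ∧
        x ∈ (MapSeq.const φ).wordMap J '' U J.1}.encard ≤ γ := by
  by_cases hI : ∃ I ∈ W₀, x ∈ (MapSeq.const φ).wordMap I '' U I.1
  · obtain ⟨I, hI, hx⟩ := hI
    refine (encard_le_encard ?_).trans (h I hI)
    rintro f ⟨J, hJ, hf, hxJ⟩
    exact ⟨J, hJ, hf, x, hxJ, hx⟩
  · have : {f : X → Euc d | ∃ J ∈ W₀, f = X.domRestrict ((MapSeq.const φ).wordMap J) ∧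
        x ∈ (MapSeq.const φ).wordMap J '' U J.1} = ∅ := by
      rw [eq_empty_iff_forall_notMem]
      rintro f ⟨J, hJ, _, hx⟩
      exact hI ⟨J, hJ, hx⟩
    rw [this, encard_empty]
    exact zero_le

theorem boundedOverlap_of_mwsc {ρ : MetricSpace (Euc d)} (h : (MapSeq.const φ).MWSC X ρ) :
    BoundedOverlap φ X ((MapSeq.const φ).cut X ρ) := by
  obtain ⟨U, hU, hpos, γ, hγ⟩ := h
  exact ⟨U, hU, hpos, γ, fun b hb0 hb1 x _ => encard_through_point_le (hγ b hb0 hb1) x⟩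

theorem boundedOverlap_of_wsc (h : WSC φ X W) : BoundedOverlap φ X W := by
  obtain ⟨U, hU, hUm, hpos, γ, hγ⟩ := h
  exact ⟨fun _ => U, fun _ => ⟨hU, hUm⟩, by rwa [iInf_const], γ,
    fun b hb0 hb1 x _ => encard_through_point_le (U := fun _ => U) (hγ b hb0 hb1) x⟩

theorem boundedOverlap_of_pointwiseWSC (h : PointwiseWSC φ X W) : BoundedOverlap φ X W := by
  obtain ⟨D, hD, hne, -, γ, hγ⟩ := h
  -- D need not be measurable; its interior is, and has positive volume.
  refine ⟨fun _ => interior D, fun _ => ⟨interior_subset.trans hD,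
    isOpen_interior.measurableSet.nullMeasurableSet⟩, ?_, γ, fun b hb0 hb1 x hx => ?_⟩
  · rw [iInf_const]
    exact isOpen_interior.measure_pos _ hne
  · refine (encard_le_encard ?_).trans (hγ b hb0 hb1 x hx)
    rintro f ⟨J, hJ, hf, hxJ⟩
    exact ⟨J, hJ, hf, image_mono interior_subset hxJ⟩

theorem BoundedOverlap.volume_pos (h : BoundedOverlap φ X W) : 0 < volume X := by
  obtain ⟨U, hU, hpos, -⟩ := h
  exact (hpos.trans_le (iInf_le _ 0)).trans_le (measure_mono (hU 0).1)

theorem wsc_of_boundedNeighbours (hX : IsCompact X) (hvol : 0 < volume X)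
    (h : BoundedNeighbours φ X W) : WSC φ X W :=
  ⟨X, Subset.rfl, hX.measurableSet.nullMeasurableSet, hvol, h⟩

theorem mwsc_of_boundedNeighbours (hX : IsCompact X) (hvol : 0 < volume X)
    {ρ : MetricSpace (Euc d)} (h : BoundedNeighbours φ X ((MapSeq.const φ).cut X ρ)) :
    (MapSeq.const φ).MWSC X ρ :=
  ⟨fun _ => X, fun _ => ⟨Subset.rfl, hX.measurableSet.nullMeasurableSet⟩, by rwa [iInf_const], h⟩

theorem pointwiseWSC_of_boundedNeighbours (hX : (interior X).Nonempty)
    (hmaps : ∀ j, MapsTo (φ j) X X) (h : BoundedNeighbours φ X W) : PointwiseWSC φ X W := by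
  obtain ⟨γ, hγ⟩ := h
  exact ⟨X, Subset.rfl, hX, fun j => (hmaps j).image_subset, γ,
    fun b hb0 hb1 x _ => encard_through_point_le (U := fun _ => X) (hγ b hb0 hb1) x⟩

variable {s : List (Fin m) → ℝ}

namespace ScaledIFS

-- Since the indexed words give distinct maps, the multiplicity of their images at a point is
-- bounded by the number of maps counted in `BoundedOverlap`, and `exists_card_bound` applies.
open Classical in
theorem exists_overlap_bound (h : ScaledIFS φ X s) (hov : BoundedOverlap φ X W) {M κ : ℝ}
    (hM : 0 ≤ M) (hκ : 0 < κ) : ∃ N : ℕ, ∀ b : ℝ, 0 < b → b < 1 → ∀ {ι : Type} (S : Finset ι)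
      (J : ι → Word (MapSeq.const φ).N) (r : ℝ) (B : Set (Euc d)), 0 < r →
      volume B ≤ ENNReal.ofReal (M * r ^ d) → (∀ i ∈ S, J i ∈ W b) →
      InjOn (fun i => X.domRestrict (listMap φ (letters (J i)))) S →
      (∀ i ∈ S, κ * r ≤ s (letters (J i))) → (∀ i ∈ S, listMap φ (letters (J i)) '' X ⊆ B) →
      S.card ≤ N := by
  obtain ⟨U, hU, hpos, γ, hγ⟩ := hov
  obtain ⟨δ, hδ0, hδ⟩ := ENNReal.lt_iff_exists_real_btwn.1 hpos
  have hδpos : 0 < δ := by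
    rcases lt_or_ge 0 δ with h0 | h0
    · exact h0
    · simp [ENNReal.ofReal_of_nonpos h0] at hδ
  obtain ⟨N, hN⟩ := h.exists_card_bound hM hκ hδpos γ
  refine ⟨N, fun b hb0 hb1 {ι} S J r B hr hB hJ hinj hs hsub => ?_⟩
  refine hN S (fun i => letters (J i)) (fun i => U (J i).1) r B hr hB
    (fun i _ => ⟨(hU _).1, (hU _).2, hδ.2.le.trans (iInf_le _ _)⟩) hs
    (fun i hi => (image_mono (hU _).1).trans (hsub i hi)) fun x => ?_
  by_cases hx : x ∈ X
  · have hcard := hγ b hb0 hb1 x hx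
    have hle : (((S.filter fun i => x ∈ listMap φ (letters (J i)) '' U (J i).1).image
        fun i => X.domRestrict (listMap φ (letters (J i))) : Finset (X → Euc d)) :
          Set (X → Euc d)).encard ≤ γ := by
      refine (encard_le_encard ?_).trans hcard
      intro f hf
      simp only [Finset.coe_image, mem_image, Finset.mem_coe, Finset.mem_filter] at hf
      obtain ⟨i, ⟨hi, hxi⟩, rfl⟩ := hf
      exact ⟨J i, hJ i hi, by rw [wordMap_const], by rw [wordMap_const]; exact hxi⟩
    rw [Set.encard_coe_eq_coe_finsetCard, Finset.card_image_of_injOn] at hle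
    · exact_mod_cast hle
    · exact hinj.mono (Finset.coe_subset.2 (Finset.filter_subset _ _))
  · rw [Finset.filter_false_of_mem]
    · simp
    · rintro i _ hxi
      exact hx ((image_mono (hU _).1).trans (mapsTo_listMap h.mapsTo _).image_subset hxi)

/-- Bounded overlaps give bounded numbers of neighbours if the words in each `W b` have comparable
sizes. -/
theorem boundedNeighbours_of_boundedOverlap (h : ScaledIFS φ X s) (hov : BoundedOverlap φ X W)
    (hcomp : ∃ κ > 0, ∀ b : ℝ, 0 < b → b < 1 → ∀ I ∈ W b, ∀ J ∈ W b,
      κ * s (letters I) ≤ s (letters J)) : BoundedNeighbours φ X W := by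
  obtain ⟨κ, hκ, hcomp⟩ := hcomp
  obtain ⟨M, hM, hreg⟩ := h.region κ hκ
  obtain ⟨N, hN⟩ := h.exists_overlap_bound hov hM hκ
  refine ⟨N, fun b hb0 hb1 I hI => encard_le_of_forall_finset fun S hS => ?_⟩
  obtain ⟨B, hB, hreg⟩ := hreg (letters I)
  have hex : ∀ f : X → Euc d, ∃ J, f ∈ S → J ∈ W b ∧
      f = X.domRestrict (listMap φ (letters J)) ∧
      (listMap φ (letters J) '' X ∩ listMap φ (letters I) '' X).Nonempty := by
    intro f
    by_cases hf : f ∈ S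
    · obtain ⟨J, hJ⟩ := hS hf
      exact ⟨J, fun _ => by simpa only [wordMap_const] using hJ⟩
    · exact ⟨I, fun h => absurd h hf⟩
  choose J hJ using hex
  refine hN b hb0 hb1 S J _ B (h.pos _) hB (fun f hf => (hJ f hf).1) ?_
    (fun f hf => hcomp b hb0 hb1 I hI _ (hJ f hf).1) fun f hf => hreg _
      (hcomp b hb0 hb1 I hI _ (hJ f hf).1) (hcomp b hb0 hb1 _ (hJ f hf).1 I hI) (hJ f hf).2.2
  intro f hf g hg hfg
  rw [(hJ f hf).2.1, (hJ g hg).2.1]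
  exact hfg

end ScaledIFS

/-- For each `κ`, the number of distinct maps `φ_J` with `s J` comparable to `s I` up to `κ`
and `φ_J(X)` meeting `φ_I(X)` is bounded. -/
def BoundedComparable (φ : Fin m → Euc d → Euc d) (X : Set (Euc d))
    (s : List (Fin m) → ℝ) : Prop :=
  ∀ κ > 0, ∃ N : ℕ, ∀ I, {f : X → Euc d | ∃ J, f = X.domRestrict (listMap φ J) ∧
    κ * s I ≤ s J ∧ κ * s J ≤ s I ∧ (listMap φ J '' X ∩ listMap φ I '' X).Nonempty}.encard ≤ N

theorem BoundedComparable.boundedNeighbours (h : BoundedComparable φ X s)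
    (hcomp : ∃ κ > 0, ∀ b : ℝ, 0 < b → b < 1 → ∀ I ∈ W b, ∀ J ∈ W b,
      κ * s (letters I) ≤ s (letters J)) : BoundedNeighbours φ X W := by
  obtain ⟨κ, hκ, hcomp⟩ := hcomp
  obtain ⟨N, hN⟩ := h κ hκ
  refine ⟨N, fun b hb0 hb1 I hI => (encard_le_encard ?_).trans (hN (letters I))⟩
  rintro f ⟨J, hJ, hf, hne⟩
  rw [wordMap_const] at hf
  rw [wordMap_const, wordMap_const] at hne
  exact ⟨_, hf, hcomp b hb0 hb1 I hI J hJ, hcomp b hb0 hb1 J hJ I hI, hne⟩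

namespace ScaledIFS

open Classical in
/-- Bounded overlaps bound the number of neighbours of comparable size if words of comparable size
can be extended, in finitely many ways, into a common `W b`, and if a map is determined by its
composition with any `φ_R`. -/
theorem boundedComparable_of_boundedOverlap (h : ScaledIFS φ X s) (hov : BoundedOverlap φ X W)
    (hrigid : ∀ J J' R, EqOn (listMap φ (J ++ R)) (listMap φ (J' ++ R)) X →
      EqOn (listMap φ J) (listMap φ J') X)
    (hext : ∀ κ > 0, ∃ 𝓡 : Finset (List (Fin m)), ∀ I, ∃ b : ℝ, 0 < b ∧ b < 1 ∧
      ∀ J, κ * s I ≤ s J → κ * s J ≤ s I → ∃ R ∈ 𝓡, ofLetters (J ++ R) ∈ W b) :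
    BoundedComparable φ X s := by
  intro κ hκ
  obtain ⟨𝓡, hext⟩ := hext κ hκ
  obtain ⟨C, hC, hmul⟩ := h.quasiMul
  obtain ⟨θ, hθ, hθR⟩ := exists_pos_le_of_finite (fun R : 𝓡 => s R) fun R => h.pos _
  obtain ⟨M, hM, hreg⟩ := h.region κ hκ
  -- Appending a word of the finite set shrinks the size at worst by the factor θ / C.
  obtain ⟨N, hN⟩ := h.exists_overlap_bound hov hM (κ := κ * θ / C) (by positivity)
  refine ⟨N * 𝓡.card, fun I => encard_le_of_forall_finset fun S hS => ?_⟩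
  obtain ⟨b, hb0, hb1, hext⟩ := hext I
  obtain ⟨B, hB, hreg⟩ := hreg I
  have hex : ∀ f : X → Euc d, ∃ J, f ∈ S → f = X.domRestrict (listMap φ J) ∧
    κ * s I ≤ s J ∧ κ * s J ≤ s I ∧ (listMap φ J '' X ∩ listMap φ I '' X).Nonempty := by
    intro f
    by_cases hf : f ∈ S
    · obtain ⟨J, hJ⟩ := hS hf
      exact ⟨J, fun _ => hJ⟩
    · exact ⟨I, fun h => absurd h hf⟩
  choose J hJ using hex
  have hexR : ∀ f : X → Euc d, ∃ R, f ∈ S → R ∈ 𝓡 ∧ ofLetters (J f ++ R) ∈ W b := by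
    intro f
    by_cases hf : f ∈ S
    · obtain ⟨R, hR⟩ := hext (J f) (hJ f hf).2.1 (hJ f hf).2.2.1
      exact ⟨R, fun _ => hR⟩
    · exact ⟨[], fun h => absurd h hf⟩
  choose R hR using hexR
  -- The maps are grouped by the appended word Q. Within a group, rigidity shows that distinct maps
  -- stay distinct after composition with φ_Q.
  refine Finset.card_le_mul_card_image_of_maps_to (f := R) (fun f hf => (hR f hf).1) N fun Q hQ => ?_
  have hmem : ∀ f ∈ S.filter (fun f => R f = Q), f ∈ S ∧ R f = Q := fun f hf =>
    Finset.mem_filter.1 hf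
  refine hN b hb0 hb1 _ (fun f => ofLetters (J f ++ R f)) _ B (h.pos I) hB
    (fun f hf => (hR f (hmem f hf).1).2) ?_ ?_ ?_
  · intro f hf g hg hfg
    have hf' := hmem f hf
    have hg' := hmem g hg
    simp only [letters_ofLetters, hf'.2, hg'.2] at hfg
    have heq : EqOn (listMap φ (J f)) (listMap φ (J g)) X := by
      refine hrigid _ _ Q fun x hx => ?_
      exact congrFun hfg ⟨x, hx⟩
    rw [(hJ f hf'.1).1, (hJ g hg'.1).1]
    funext x
    exact heq x.2
  · intro f hf
    have hf' := hmem f hf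
    rw [letters_ofLetters, div_mul_eq_mul_div, div_le_iff₀ (by positivity)]
    have h1 := (hmul (J f) (R f)).2
    have h2 := (hJ f hf'.1).2.1
    have h3 : θ ≤ s (R f) := hθR ⟨R f, (hR f hf'.1).1⟩
    calc κ * θ * s I = (κ * s I) * θ := by ring
      _ ≤ s (J f) * s (R f) := mul_le_mul h2 h3 hθ.le (h.pos _).le
      _ ≤ C * s (J f ++ R f) := h1
      _ = _ := mul_comm _ _
  · intro f hf
    have hf' := hmem f hf
    rw [letters_ofLetters]
    exact (image_listMap_append_subset h.mapsTo _ _).trans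
      (hreg _ (hJ f hf'.1).2.1 (hJ f hf'.1).2.2.1 (hJ f hf'.1).2.2.2)

end ScaledIFS

end Overlaps

/-! ### Contraction for ρ and the upper ratios R_J. -/

section Metric

variable {d m : ℕ} {φ : Fin m → Euc d → Euc d} {X : Set (Euc d)} {ρ : MetricSpace (Euc d)}

theorem rdist_nonneg (ρ : MetricSpace (Euc d)) (x y : Euc d) : 0 ≤ rdist ρ x y :=
  @dist_nonneg _ ρ.toPseudoMetricSpace x y

theorem rdist_pos {x y : Euc d} (h : x ≠ y) : 0 < rdist ρ x y :=
  (@dist_pos _ ρ x y).2 h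

theorem rdist_self (ρ : MetricSpace (Euc d)) (x : Euc d) : rdist ρ x x = 0 :=
  @dist_self _ ρ.toPseudoMetricSpace x

theorem contractsOn_mapsTo (h : (MapSeq.const φ).ContractsOn X ρ) (j : Fin m) :
    MapsTo (φ j) X X := by
  obtain ⟨c₁, c₂, -, -, hc⟩ := h
  exact (hc 0 j).1

theorem contractsOn_injOn (h : (MapSeq.const φ).ContractsOn X ρ) (j : Fin m) :
    InjOn (φ j) X := by
  obtain ⟨c₁, c₂, h0, -, hc⟩ := h
  intro x hx y hy hxy
  by_contra hne
  have h1 : c₁ 0 * rdist ρ x y ≤ rdist ρ (φ j x) (φ j y) := ((hc 0 j).2 x hx y hy).1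
  rw [hxy, rdist_self] at h1
  exact absurd h1 (not_le.2 (mul_pos (h0 0).1 (rdist_pos hne)))

/-- All layers carry the same maps, so the constant of layer 0 can be used at every step and the
contraction is geometric. -/
theorem contractsOn_exists_ratio (h : (MapSeq.const φ).ContractsOn X ρ) :
    ∃ c : ℝ, 0 < c ∧ c < 1 ∧ ∀ J, ∀ x ∈ X, ∀ y ∈ X,
      rdist ρ (listMap φ J x) (listMap φ J y) ≤ c ^ J.length * rdist ρ x y := by
  have hmaps := contractsOn_mapsTo h
  obtain ⟨c₁, c₂, h0, -, hc⟩ := h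
  have hc2 : 0 < c₂ 0 := (h0 0).1.trans_le (h0 0).2.1
  refine ⟨c₂ 0, hc2, (h0 0).2.2, fun J x hx y hy => ?_⟩
  induction J with
  | nil => simp
  | cons j J ih =>
    have h1 : rdist ρ (φ j (listMap φ J x)) (φ j (listMap φ J y)) ≤
        c₂ 0 * rdist ρ (listMap φ J x) (listMap φ J y) :=
      ((hc 0 j).2 _ (mapsTo_listMap hmaps J hx) _ (mapsTo_listMap hmaps J hy)).2
    refine h1.trans ?_
    rw [List.length_cons, pow_succ', mul_assoc]
    exact mul_le_mul_of_nonneg_left ih hc2.le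

/-- A family contracting for `ρ` contracts for the Euclidean metric up to a constant. -/
theorem contractsOn_exists_norm_ratio (h : (MapSeq.const φ).ContractsOn X ρ)
    (hρ : BiLipEquivOn ρ X) : ∃ a c : ℝ, 0 < a ∧ 0 < c ∧ c < 1 ∧ ∀ J, ∀ x ∈ X, ∀ y ∈ X,
      ‖listMap φ J x - listMap φ J y‖ ≤ a * c ^ J.length * ‖x - y‖ := by
  have hmaps := contractsOn_mapsTo h
  obtain ⟨c, hc0, hc1, hc⟩ := contractsOn_exists_ratio h
  obtain ⟨a, ha, hbi⟩ := hρ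
  have ha0 : 0 < a := by positivity
  refine ⟨a * a, c, by positivity, hc0, hc1, fun J x hx y hy => ?_⟩
  have h1 := (hbi x hx y hy).1
  rw [inv_mul_le_iff₀ ha0] at h1
  calc _ ≤ a * rdist ρ (listMap φ J x) (listMap φ J y) :=
        (hbi _ (mapsTo_listMap hmaps J hx) _ (mapsTo_listMap hmaps J hy)).2
    _ ≤ a * (c ^ J.length * (a * ‖x - y‖)) := by
        gcongr
        exact (hc J x hx y hy).trans (by gcongr)
    _ = _ := by ring

theorem contractsOn_continuousOn (h : (MapSeq.const φ).ContractsOn X ρ)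
    (hρ : BiLipEquivOn ρ X) (j : Fin m) : ContinuousOn (φ j) X := by
  obtain ⟨a, c, ha, hc0, hc1, hc⟩ := contractsOn_exists_norm_ratio h hρ
  have hl : LipschitzOnWith (Real.toNNReal (a * c ^ 1)) (φ j) X := by
    refine LipschitzOnWith.of_dist_le_mul fun x hx y hy => ?_
    rw [Real.coe_toNNReal _ (by positivity), dist_eq_norm, dist_eq_norm]
    exact hc [j] x hx y hy
  exact hl.continuousOn

theorem shrinksOn_of_contractsOn (hX : IsCompact X) (h : (MapSeq.const φ).ContractsOn X ρ)
    (hρ : BiLipEquivOn ρ X) : ShrinksOn φ X := by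
  obtain ⟨a, c, ha, hc0, hc1, hc⟩ := contractsOn_exists_norm_ratio h hρ
  refine ⟨a * Metric.diam X, c, by positivity, hc0, hc1, fun J x hx y hy => ?_⟩
  have hd := Metric.dist_le_diam_of_mem hX.isBounded hx hy
  rw [dist_eq_norm] at hd ⊢
  calc _ ≤ a * c ^ J.length * ‖x - y‖ := hc J x hx y hy
    _ ≤ a * c ^ J.length * Metric.diam X := by gcongr
    _ = _ := by ring

theorem isMIFS_mssc_iff_ssc (h : (MapSeq.const φ).IsMIFS X ρ) (hρ : BiLipEquivOn ρ X) :
    (MapSeq.const φ).MSSC X ↔ SSC φ X :=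
  mssc_iff_ssc h.nonempty h.compact (contractsOn_mapsTo h.contracts)
    (contractsOn_injOn h.contracts) (contractsOn_continuousOn h.contracts hρ)
    (shrinksOn_of_contractsOn h.compact h.contracts hρ) (two_pos.trans_le (h.two_le 0))

theorem biLipEquivOn_eucMetric (X : Set (Euc d)) : BiLipEquivOn (eucMetric d) X := by
  refine ⟨1, le_rfl, fun x _ y _ => ?_⟩
  have : rdist (eucMetric d) x y = ‖x - y‖ := dist_eq_norm x y
  simp [this]

/-- The upper contraction ratio of `φ_J`, for a word given as a list. -/
def listRatio (φ : Fin m → Euc d → Euc d) (X : Set (Euc d)) (ρ : MetricSpace (Euc d))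
    (J : List (Fin m)) : ℝ :=
  sSup {r : ℝ | ∃ x ∈ X, ∃ y ∈ X, x ≠ y ∧
    r = rdist ρ (listMap φ J x) (listMap φ J y) / rdist ρ x y}

theorem upperRatio_const (J : Word (MapSeq.const φ).N) :
    (MapSeq.const φ).upperRatio X ρ J = listRatio φ X ρ (letters J) := by
  rw [MapSeq.upperRatio, listRatio, wordMap_const]

theorem mem_cut_const {b : ℝ} {J : Word (MapSeq.const φ).N} :
    J ∈ (MapSeq.const φ).cut X ρ b ↔
      listRatio φ X ρ (letters J) ≤ b ∧ b < listRatio φ X ρ (letters J).dropLast := by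
  have h1 := upperRatio_const (φ := φ) (X := X) (ρ := ρ) J
  have h2 := (upperRatio_const (φ := φ) (X := X) (ρ := ρ) J.dropLast).trans
    (congrArg (listRatio φ X ρ) (letters_dropLast (m := m) J))
  rw [← h1, ← h2]
  rfl

theorem rdist_le_listRatio (h : (MapSeq.const φ).ContractsOn X ρ) (J : List (Fin m)) {x y : Euc d}
    (hx : x ∈ X) (hy : y ∈ X) :
    rdist ρ (listMap φ J x) (listMap φ J y) ≤ listRatio φ X ρ J * rdist ρ x y := by
  obtain ⟨c, hc0, hc1, hc⟩ := contractsOn_exists_ratio h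
  rcases eq_or_ne x y with rfl | hne
  · simp [rdist_self]
  · rw [← div_le_iff₀ (rdist_pos hne)]
    refine le_csSup ⟨c ^ J.length, ?_⟩ ⟨x, hx, y, hy, hne, rfl⟩
    rintro _ ⟨x, hx, y, hy, hne, rfl⟩
    rw [div_le_iff₀ (rdist_pos hne)]
    exact hc J x hx y hy

theorem listRatio_le {J : List (Fin m)} {K : ℝ} (hK : 0 ≤ K) (h : ∀ x ∈ X, ∀ y ∈ X,
    rdist ρ (listMap φ J x) (listMap φ J y) ≤ K * rdist ρ x y) : listRatio φ X ρ J ≤ K := by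
  refine Real.sSup_le ?_ hK
  rintro _ ⟨x, hx, y, hy, hne, rfl⟩
  rw [div_le_iff₀ (rdist_pos hne)]
  exact h x hx y hy

theorem listRatio_nonneg (J : List (Fin m)) : 0 ≤ listRatio φ X ρ J := by
  refine Real.sSup_nonneg ?_
  rintro _ ⟨x, -, y, -, -, rfl⟩
  exact div_nonneg (rdist_nonneg _ _ _) (rdist_nonneg _ _ _)

theorem exists_listRatio_append_le (h : (MapSeq.const φ).ContractsOn X ρ) :
    ∃ c : ℝ, 0 < c ∧ c < 1 ∧ (∀ J, listRatio φ X ρ J ≤ 1) ∧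
      ∀ I J, listRatio φ X ρ (I ++ J) ≤ listRatio φ X ρ I * c ^ J.length := by
  have hmaps := contractsOn_mapsTo h
  obtain ⟨c, hc0, hc1, hc⟩ := contractsOn_exists_ratio h
  refine ⟨c, hc0, hc1, fun J => listRatio_le zero_le_one fun x hx y hy => ?_, fun I J => ?_⟩
  · exact (hc J x hx y hy).trans
      (mul_le_mul_of_nonneg_right (pow_le_one₀ hc0.le hc1.le) (rdist_nonneg _ _ _))
  · have hI := listRatio_nonneg (φ := φ) (X := X) (ρ := ρ) I
    refine listRatio_le (by positivity) fun x hx y hy => ?_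
    rw [listMap_append, mul_assoc]
    exact (rdist_le_listRatio h I (mapsTo_listMap hmaps J hx) (mapsTo_listMap hmaps J hy)).trans
      (mul_le_mul_of_nonneg_left (hc J x hx y hy) hI)

/-- The least number of copies of z that brings R down to b works; it is not 0 because R J exceeds
b. Applied to both notions of size, it puts words into Γ_b and 𝓘_b. -/
theorem exists_replicate_extension (R : List (Fin m) → ℝ) (z : Fin m) {b : ℝ} {J : List (Fin m)}
    {L : ℕ} (hJ : b < R J) (hL : R (J ++ List.replicate L z) ≤ b) :
    ∃ k ≤ L, R (J ++ List.replicate k z) ≤ b ∧ b < R (J ++ List.replicate k z).dropLast := by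
  classical
  have hex : ∃ k, R (J ++ List.replicate k z) ≤ b := ⟨L, hL⟩
  refine ⟨Nat.find hex, Nat.find_le hL, Nat.find_spec hex, ?_⟩
  rcases hk : Nat.find hex with _ | k
  · have := Nat.find_spec hex
    rw [hk] at this
    simp only [List.replicate_zero, List.append_nil] at this
    exact absurd this (not_le.2 hJ)
  · have := Nat.find_min hex (m := k) (by omega)
    rw [List.replicate_succ', ← List.append_assoc, List.dropLast_concat]
    exact not_le.1 this

end Metric

/-! ### The generalized self-affine case. -/

section Affine

variable {d m : ℕ}

/-- The linear part `A_J⁻¹ = A_{j_1}⁻¹ ⋯ A_{j_k}⁻¹` of `φ_J`. -/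
def linPart (A : Fin m → (Euc d ≃L[ℝ] Euc d)) : List (Fin m) → (Euc d ≃L[ℝ] Euc d)
  | [] => ContinuousLinearEquiv.refl ℝ (Euc d)
  | j :: J => (linPart A J).trans (A j).symm

theorem linPart_append (A : Fin m → (Euc d ≃L[ℝ] Euc d)) (I J : List (Fin m)) (v : Euc d) :
    linPart A (I ++ J) v = linPart A I (linPart A J v) := by
  induction I with
  | nil => rfl
  | cons i I ih => simp [linPart, ih]

theorem wordMatrix_symm (A : Fin m → (Euc d ≃L[ℝ] Euc d)) (k : ℕ) (w : Fin k → Fin m) :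
    (wordMatrix A k w).symm = linPart A (List.ofFn w) := by
  induction k with
  | zero => simp only [List.ofFn_zero]; rfl
  | succ k ih =>
    rw [List.ofFn_succ_last]
    refine ContinuousLinearEquiv.ext (funext fun v => ?_)
    rw [linPart_append, ← ih]
    rfl

theorem wordMatrix_eq (A : Fin m → (Euc d ≃L[ℝ] Euc d)) (k : ℕ) (w : Fin k → Fin m) :
    wordMatrix A k w = (linPart A (List.ofFn w)).symm := by
  rw [← wordMatrix_symm, ContinuousLinearEquiv.symm_symm]

/-- The size `|det A_J⁻¹| ^ (1 / d)` of a word. -/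
def detSize (A : Fin m → (Euc d ≃L[ℝ] Euc d)) (J : List (Fin m)) : ℝ :=
  |LinearMap.det (linPart A J : Euc d →ₗ[ℝ] Euc d)| ^ ((d : ℝ)⁻¹)

theorem abs_det_linPart_pos (A : Fin m → (Euc d ≃L[ℝ] Euc d)) (J : List (Fin m)) :
    0 < |LinearMap.det (linPart A J : Euc d →ₗ[ℝ] Euc d)| :=
  abs_pos.2 (LinearEquiv.isUnit_det' (linPart A J).toLinearEquiv).ne_zero

theorem detSize_pos (A : Fin m → (Euc d ≃L[ℝ] Euc d)) (J : List (Fin m)) : 0 < detSize A J :=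
  Real.rpow_pos_of_pos (abs_det_linPart_pos A J) _

theorem detSize_pow (hd : 1 ≤ d) (A : Fin m → (Euc d ≃L[ℝ] Euc d)) (J : List (Fin m)) :
    detSize A J ^ d = |LinearMap.det (linPart A J : Euc d →ₗ[ℝ] Euc d)| :=
  Real.rpow_inv_natCast_pow (abs_nonneg _) (by omega)

theorem detSize_append (A : Fin m → (Euc d ≃L[ℝ] Euc d)) (I J : List (Fin m)) :
    detSize A (I ++ J) = detSize A I * detSize A J := by
  rw [detSize, detSize, detSize, ← Real.mul_rpow (abs_nonneg _) (abs_nonneg _), ← abs_mul,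
    ← LinearMap.det_comp]
  congr 3
  ext1 v
  exact linPart_append A I J v

@[simp] theorem detSize_nil (A : Fin m → (Euc d ≃L[ℝ] Euc d)) : detSize A [] = 1 := by
  have h := detSize_append A [] []
  rw [List.append_nil] at h
  exact (mul_eq_left₀ (detSize_pos A []).ne').1 h.symm

theorem detRatio_eq (hd : 1 ≤ d) (A : Fin m → (Euc d ≃L[ℝ] Euc d)) (J : Word (fun _ => m)) :
    detRatio A J = detSize A (letters J) ^ d := by
  rw [detSize_pow hd, detRatio, wordMatrix_symm]
  rfl

theorem mem_detCut (hd : 1 ≤ d) {A : Fin m → (Euc d ≃L[ℝ] Euc d)} {b : ℝ} (hb : 0 < b)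
    {J : Word (fun _ => m)} : J ∈ detCut A b ↔
      detSize A (letters J) ≤ b ∧ b < detSize A (letters J).dropLast := by
  have hd0 : d ≠ 0 := by omega
  rw [← letters_dropLast, ← pow_le_pow_iff_left₀ (detSize_pos A _).le hb.le hd0,
    ← pow_lt_pow_iff_left₀ hb.le (detSize_pos A _).le hd0, ← detRatio_eq hd, ← detRatio_eq hd]
  rfl

/-- A generalized self-affine Moran-type system on a set of positive volume satisfying the
homogeneity condition. -/
structure AffineSetting (φ : Fin m → Euc d → Euc d) (X : Set (Euc d)) (ρ : MetricSpace (Euc d))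
    (A : Fin m → (Euc d ≃L[ℝ] Euc d)) (α : Fin m → Euc d) : Prop where
  dim : 1 ≤ d
  mifs : (MapSeq.const φ).IsMIFS X ρ
  biLip : BiLipEquivOn ρ X
  affine : IsGenSelfAffine φ X A α
  homogeneous : WeaklyHomogeneous A
  volume_pos : 0 < volume X

namespace AffineSetting

variable {φ : Fin m → Euc d → Euc d} {X : Set (Euc d)} {ρ : MetricSpace (Euc d)}
  {A : Fin m → (Euc d ≃L[ℝ] Euc d)} {α : Fin m → Euc d}

theorem mapsTo (h : AffineSetting φ X ρ A α) : ∀ j, MapsTo (φ j) X X :=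
  contractsOn_mapsTo h.mifs.contracts

theorem sub_eq (h : AffineSetting φ X ρ A α) (J : List (Fin m)) {x y : Euc d} (hx : x ∈ X)
    (hy : y ∈ X) : listMap φ J x - listMap φ J y = linPart A J (x - y) := by
  induction J with
  | nil => rfl
  | cons j J ih =>
    simp only [listMap_cons, Function.comp_apply, linPart, ContinuousLinearEquiv.trans_apply]
    rw [h.affine j _ (mapsTo_listMap h.mapsTo J hx), h.affine j _ (mapsTo_listMap h.mapsTo J hy),
      ← map_sub, add_sub_add_right_eq_sub, ih]

theorem image_eq (h : AffineSetting φ X ρ A α) (J : List (Fin m)) {U : Set (Euc d)} (hU : U ⊆ X)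
    {p : Euc d} (hp : p ∈ X) : listMap φ J '' U =
      (fun v => (listMap φ J p - linPart A J p) + v) '' (linPart A J '' U) := by
  rw [← image_comp]
  refine image_congr fun x hx => ?_
  have := h.sub_eq J (hU hx) hp
  rw [map_sub] at this
  simp only [Function.comp_apply]
  rw [eq_add_of_sub_eq this]
  abel

theorem volume_linPart_image (hd : 1 ≤ d) (J : List (Fin m)) (U : Set (Euc d)) :
    volume (linPart A J '' U) = ENNReal.ofReal (detSize A J ^ d) * volume U := by
  rw [detSize_pow hd, ← Measure.addHaar_image_linearMap]
  rfl

theorem volume_image (h : AffineSetting φ X ρ A α) (J : List (Fin m)) {U : Set (Euc d)}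
    (hU : U ⊆ X) :
    volume (listMap φ J '' U) = ENNReal.ofReal (detSize A J ^ d) * volume U := by
  obtain ⟨p, hp⟩ := h.mifs.nonempty
  rw [h.image_eq J hU hp, image_add_left, measure_preimage_add, volume_linPart_image h.dim]

theorem volume_ne_top (h : AffineSetting φ X ρ A α) : volume X ≠ ⊤ :=
  h.mifs.compact.measure_lt_top.ne

theorem detSize_le_one (h : AffineSetting φ X ρ A α) (J : List (Fin m)) : detSize A J ≤ 1 := by
  have h1 : volume (listMap φ J '' X) ≤ volume X :=
    measure_mono (mapsTo_listMap h.mapsTo J).image_subset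
  rw [h.volume_image J Subset.rfl] at h1
  have h2 : ENNReal.ofReal (detSize A J ^ d) ≤ 1 := by
    refine (ENNReal.mul_le_mul_iff_left h.volume_pos.ne' h.volume_ne_top).1 ?_
    rwa [one_mul]
  rw [ENNReal.ofReal_le_one] at h2
  exact (pow_le_one_iff_of_nonneg (detSize_pos A J).le (by have := h.dim; omega)).1 h2

theorem detSize_replicate (j : Fin m) (k : ℕ) :
    detSize A (List.replicate k j) = detSize A [j] ^ k := by
  induction k with
  | zero => simp
  | succ k ih => rw [List.replicate_succ', detSize_append, ih, pow_succ]

/-- With determinant of modulus 1 the iterates of φ_j would preserve the positive volume of X, while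
their images of X lie in balls of radius tending to 0. -/
theorem detSize_letter_lt_one (h : AffineSetting φ X ρ A α) (j : Fin m) : detSize A [j] < 1 := by
  refine lt_of_le_of_ne (h.detSize_le_one _) fun heq => ?_
  obtain ⟨C, c, hC, hc0, hc1, hs⟩ := shrinksOn_of_contractsOn h.mifs.compact h.mifs.contracts
    h.biLip
  obtain ⟨p, hp⟩ := h.mifs.nonempty
  have hle : ∀ k : ℕ, volume X ≤ ENNReal.ofReal ((C * c ^ k) ^ d) *
      volume (Metric.ball (0 : Euc d) 1) := by
    intro k
    have h1 := h.volume_image (List.replicate k j) Subset.rfl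
    rw [detSize_replicate, heq, one_pow, one_pow, ENNReal.ofReal_one, one_mul] at h1
    rw [← h1]
    have h2 : listMap φ (List.replicate k j) '' X ⊆
        Metric.closedBall (listMap φ (List.replicate k j) p) (C * c ^ k) := by
      rintro _ ⟨x, hx, rfl⟩
      have := hs (List.replicate k j) x hx p hp
      rwa [List.length_replicate] at this
    refine (measure_mono h2).trans ?_
    rw [Measure.addHaar_closedBall _ _ (by positivity)]
    simp
  have ht : Tendsto (fun k : ℕ => ENNReal.ofReal ((C * c ^ k) ^ d) *
      volume (Metric.ball (0 : Euc d) 1)) atTop (𝓝 0) := by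
    have hd0 : d ≠ 0 := by have := h.dim; omega
    have h1 : Tendsto (fun k : ℕ => (C * c ^ k) ^ d) atTop (𝓝 0) := by
      have := ((tendsto_pow_atTop_nhds_zero_of_lt_one hc0.le hc1).const_mul C).pow d
      simpa [hd0] using this
    have h2 := ENNReal.tendsto_ofReal h1
    have := ENNReal.Tendsto.mul_const h2
      (b := volume (Metric.ball (0 : Euc d) 1)) (Or.inr Metric.isBounded_ball.measure_lt_top.ne)
    simpa using this
  exact absurd (ge_of_tendsto' ht hle) (not_le.2 h.volume_pos)

/-- Every direction is a difference of points of `X`. -/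
theorem exists_smul_eq_sub (h : AffineSetting φ X ρ A α) (v : Euc d) :
    ∃ t : ℝ, 0 < t ∧ ∃ x ∈ X, ∃ y ∈ X, t • v = x - y := by
  -- Steinhaus: X - X is a neighbourhood of 0.
  have h1 := Measure.sub_mem_nhds_zero_of_addHaar_pos volume X
    h.mifs.compact.measurableSet h.volume_pos
  have h2 : Tendsto (fun t : ℝ => t • v) (𝓝[>] 0) (𝓝 0) := by
    have : Tendsto (fun t : ℝ => t • v) (𝓝 0) (𝓝 ((0 : ℝ) • v)) :=
      (continuous_id.smul continuous_const).tendsto 0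
    rw [zero_smul] at this
    exact this.mono_left nhdsWithin_le_nhds
  obtain ⟨t, ht, ht0⟩ := ((h2.eventually h1).and self_mem_nhdsWithin).exists
  obtain ⟨x, hx, y, hy, hxy⟩ := Set.mem_sub.1 ht
  exact ⟨t, ht0, x, hx, y, hy, hxy.symm⟩

theorem exists_detCut_extension (h : AffineSetting φ X ρ A α) (z : Fin m) {q : ℝ} (hq : 0 < q) :
    ∃ L : ℕ, ∀ J b, 0 < b → q * detSize A J ≤ b → b < detSize A J →
      ∃ k ≤ L, ofLetters (J ++ List.replicate k z) ∈ detCut A b := by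
  obtain ⟨L, hL⟩ := exists_pow_lt_of_lt_one hq (h.detSize_letter_lt_one z)
  refine ⟨L, fun J b hb hqb hbJ => ?_⟩
  obtain ⟨k, hk, h1, h2⟩ := exists_replicate_extension (detSize A) z (L := L) hbJ (by
    rw [detSize_append, detSize_replicate, mul_comm]
    exact (mul_le_mul_of_nonneg_right hL.le (detSize_pos A J).le).trans hqb)
  refine ⟨k, hk, ?_⟩
  rw [mem_detCut h.dim hb, letters_ofLetters]
  exact ⟨h1, h2⟩

/-- The homogeneity condition for words of comparable size. -/
theorem exists_norm_le (h : AffineSetting φ X ρ A α) {κ : ℝ} (hκ : 0 < κ) :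
    ∃ T : ℝ, 1 ≤ T ∧ ∀ I J, κ * detSize A I ≤ detSize A J → κ * detSize A J ≤ detSize A I →
      ∀ v, ‖(linPart A I).symm (linPart A J v)‖ ≤ T * ‖v‖ := by
  obtain ⟨τ, hτ⟩ := h.homogeneous
  have z : Fin m := ⟨0, two_pos.trans_le (h.mifs.two_le 0)⟩
  set q := min κ 1 / 2 with hq
  have hq0 : 0 < q := by positivity
  have hqκ : 2 * q ≤ κ := by rw [hq]; linarith [min_le_left κ 1]
  have hq1 : 2 * q ≤ 1 := by rw [hq]; linarith [min_le_right κ 1]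
  obtain ⟨L, hL⟩ := h.exists_detCut_extension z (q := q) hq0
  -- D bounds the linear parts of all appended words and their inverses, so removing these words
  -- costs a factor D on each side.
  set D : ℝ := ∑ k ∈ Finset.range (L + 1), (‖(linPart A (List.replicate k z) : Euc d →L[ℝ] Euc d)‖ +
    ‖((linPart A (List.replicate k z)).symm : Euc d →L[ℝ] Euc d)‖) with hD
  have hD0 : 0 ≤ D := Finset.sum_nonneg fun _ _ => by positivity
  have hDk : ∀ k ≤ L, ∀ v, ‖linPart A (List.replicate k z) v‖ ≤ D * ‖v‖ ∧
      ‖(linPart A (List.replicate k z)).symm v‖ ≤ D * ‖v‖ := by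
    intro k hk v
    have h1 := Finset.single_le_sum (f := fun k =>
      ‖(linPart A (List.replicate k z) : Euc d →L[ℝ] Euc d)‖ +
      ‖((linPart A (List.replicate k z)).symm : Euc d →L[ℝ] Euc d)‖)
      (fun _ _ => by positivity) (Finset.mem_range.2 (Nat.lt_succ_of_le hk))
    have h2 := norm_nonneg (linPart A (List.replicate k z) : Euc d →L[ℝ] Euc d)
    have h3 := norm_nonneg ((linPart A (List.replicate k z)).symm : Euc d →L[ℝ] Euc d)
    rw [← hD] at h1
    exact ⟨((linPart A (List.replicate k z) : Euc d →L[ℝ] Euc d).le_opNorm v).trans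
        (mul_le_mul_of_nonneg_right (by linarith) (norm_nonneg _)),
      (((linPart A (List.replicate k z)).symm : Euc d →L[ℝ] Euc d).le_opNorm v).trans
        (mul_le_mul_of_nonneg_right (by linarith) (norm_nonneg _))⟩
  refine ⟨max 1 (D * (|τ| * D)), le_max_left _ _, fun I J hIJ hJI v => ?_⟩
  have hI := detSize_pos A I
  have hJ := detSize_pos A J
  have hI1 := h.detSize_le_one I
  -- Both sizes exceed b, and by comparability q times either is at most b; hence both words extend
  -- into the same Γ_b with at most L letters.
  set b := min (detSize A I) (detSize A J) / 2 with hb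
  have hb0 : 0 < b := by positivity
  have hbI : b < detSize A I := by rw [hb]; linarith [min_le_left (detSize A I) (detSize A J)]
  have hbJ : b < detSize A J := by rw [hb]; linarith [min_le_right (detSize A I) (detSize A J)]
  have hb1 : b < 1 := hbI.trans_le hI1
  have hqI : q * detSize A I ≤ b := by
    have : 2 * q * detSize A I ≤ min (detSize A I) (detSize A J) :=
      le_min (by nlinarith) (by nlinarith)
    rw [hb]; linarith
  have hqJ : q * detSize A J ≤ b := by
    have : 2 * q * detSize A J ≤ min (detSize A I) (detSize A J) :=
      le_min (by nlinarith) (by nlinarith)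
    rw [hb]; linarith
  obtain ⟨k, hk, hkI⟩ := hL I b hb0 hqI hbI
  obtain ⟨l, hl, hlJ⟩ := hL J b hb0 hqJ hbJ
  have key := hτ b hb0 hb1 _ hkI _ hlJ
  have key' : ∀ w, ‖(linPart A (I ++ List.replicate k z)).symm
      (linPart A (J ++ List.replicate l z) w)‖ ≤ |τ| * ‖w‖ := by
    intro w
    have h1 := ContinuousLinearMap.le_of_opNorm_le _ key w
    have e1 : List.ofFn (ofLetters (I ++ List.replicate k z)).2 = I ++ List.replicate k z :=
      letters_ofLetters _
    have e2 : List.ofFn (ofLetters (J ++ List.replicate l z)).2 = J ++ List.replicate l z :=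
      letters_ofLetters _
    rw [wordMatrix_symm, wordMatrix_eq, e1, e2] at h1
    exact h1.trans (mul_le_mul_of_nonneg_right (le_abs_self τ) (norm_nonneg _))
  have hv : (linPart A I).symm (linPart A J v) = linPart A (List.replicate k z)
      ((linPart A (I ++ List.replicate k z)).symm (linPart A (J ++ List.replicate l z)
        ((linPart A (List.replicate l z)).symm v))) := by
    rw [ContinuousLinearEquiv.symm_apply_eq, ← linPart_append,
      ContinuousLinearEquiv.apply_symm_apply, linPart_append,
      ContinuousLinearEquiv.apply_symm_apply]
  rw [hv]
  refine ((hDk k hk _).1).trans (le_trans ?_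
    (mul_le_mul_of_nonneg_right (le_max_right _ _) (norm_nonneg v)))
  rw [mul_assoc]
  refine mul_le_mul_of_nonneg_left ?_ hD0
  rw [mul_assoc]
  exact (key' _).trans (mul_le_mul_of_nonneg_left (hDk l hl v).2 (abs_nonneg τ))

theorem isOpen_image (h : AffineSetting φ X ρ A α) (j : Fin m) {V : Set (Euc d)} (hVX : V ⊆ X)
    (hV : IsOpen V) : IsOpen (φ j '' V) := by
  have : φ j '' V = (A j).symm '' ((fun x => x + α j) '' V) := by
    rw [← image_comp]
    exact image_congr fun x hx => h.affine j x (hVX hx)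
  rw [this]
  exact (A j).symm.toHomeomorph.isOpenMap _ (isOpenMap_add_right (α j) _ hV)

theorem scaledIFS (h : AffineSetting φ X ρ A α) : ScaledIFS φ X (detSize A) where
  isCompact := h.mifs.compact
  mapsTo := h.mapsTo
  injOn := contractsOn_injOn h.mifs.contracts
  continuousOn := contractsOn_continuousOn h.mifs.contracts h.biLip
  isOpen_image := fun j V hVX hV => h.isOpen_image j hVX hV
  pos := detSize_pos A
  bounded := ⟨1, h.detSize_le_one⟩
  quasiMul := ⟨1, le_rfl, fun I J => by simp [detSize_append]⟩
  volume_image := ⟨1, one_pos, fun J U hU _ => by rw [one_mul, h.volume_image J hU]⟩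
  region := by
    intro κ hκ
    obtain ⟨T, hT1, hT⟩ := h.exists_norm_le hκ
    obtain ⟨p, hp⟩ := h.mifs.nonempty
    set D := Metric.diam X
    have hdist : ∀ x ∈ X, ∀ y ∈ X, ‖x - y‖ ≤ D := fun x hx y hy => by
      rw [← dist_eq_norm]
      exact Metric.dist_le_diam_of_mem h.mifs.compact.isBounded hx hy
    have hfin : volume (Metric.closedBall (0 : Euc d) (D + T * D)) ≠ ⊤ :=
      Metric.isBounded_closedBall.measure_lt_top.ne
    -- If φ_J(x) = φ_I(y), then φ_J(w) = φ_I(p) + A_I⁻¹((y - p) + A_I A_J⁻¹(w - x)), and the vector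
    -- in the outer bracket has norm at most D + T D.
    refine ⟨(volume (Metric.closedBall (0 : Euc d) (D + T * D))).toReal, ENNReal.toReal_nonneg,
      fun I => ⟨(fun v => listMap φ I p + v) ''
        (linPart A I '' Metric.closedBall 0 (D + T * D)), ?_, ?_⟩⟩
    · rw [image_add_left, measure_preimage_add, volume_linPart_image h.dim,
        ENNReal.ofReal_mul ENNReal.toReal_nonneg, ENNReal.ofReal_toReal hfin, mul_comm]
    · rintro J hIJ hJI ⟨_, ⟨x, hx, rfl⟩, ⟨y, hy, hyx⟩⟩ _ ⟨w, hw, rfl⟩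
      refine ⟨_, ⟨(y - p) + (linPart A I).symm (linPart A J (w - x)), ?_, rfl⟩, ?_⟩
      · rw [mem_closedBall_zero_iff]
        refine (norm_add_le _ _).trans (add_le_add (hdist y hy p hp) ?_)
        exact (hT I J hIJ hJI _).trans
          (mul_le_mul_of_nonneg_left (hdist w hw x hx) (by linarith))
      · simp only [map_add, ContinuousLinearEquiv.apply_symm_apply]
        rw [← h.sub_eq I hy hp, ← h.sub_eq J hw hx, hyx]
        abel

/-- Differences of points of X point in every direction, so the linear parts of the two compositions
agree. Cancelling that of R leaves two affine maps with equal linear parts that agree at one point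
φ_R(p). -/
theorem rigid (h : AffineSetting φ X ρ A α) (J J' R : List (Fin m))
    (heq : EqOn (listMap φ (J ++ R)) (listMap φ (J' ++ R)) X) :
    EqOn (listMap φ J) (listMap φ J') X := by
  obtain ⟨p, hp⟩ := h.mifs.nonempty
  have hlin : ∀ v, linPart A (J ++ R) v = linPart A (J' ++ R) v := by
    intro v
    obtain ⟨t, ht, x, hx, y, hy, hxy⟩ := h.exists_smul_eq_sub v
    refine smul_right_injective _ ht.ne' ?_
    simp only [← map_smul]
    rw [hxy, ← h.sub_eq _ hx hy, ← h.sub_eq _ hx hy, heq hx, heq hy]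
  intro x hx
  have hR := mapsTo_listMap h.mapsTo R hp
  have h1 := h.sub_eq J hx hR
  have h2 := h.sub_eq J' hx hR
  have h3 := hlin ((linPart A R).symm (x - listMap φ R p))
  rw [linPart_append, linPart_append, ContinuousLinearEquiv.apply_symm_apply, ← h1, ← h2] at h3
  have h4 := heq hp
  rw [listMap_append, listMap_append] at h4
  simp only [Function.comp_apply] at h4
  rw [h4] at h3
  exact sub_left_injective h3

theorem detCut_comparable (h : AffineSetting φ X ρ A α) : ∃ κ > 0, ∀ b : ℝ, 0 < b → b < 1 →
    ∀ I ∈ detCut A b, ∀ J ∈ detCut A b,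
      κ * detSize A (letters I) ≤ detSize A (letters J) := by
  obtain ⟨η, hη, hlow⟩ := h.scaledIFS.exists_letter_lower
  refine ⟨η, hη, fun b hb _ I hI J hJ => ?_⟩
  rw [mem_detCut h.dim hb] at hI hJ
  have hne : letters J ≠ [] := by
    intro h0
    rw [h0] at hJ
    exact absurd hJ.1 (not_le.2 hJ.2)
  calc η * detSize A (letters I) ≤ η * detSize A (letters J).dropLast := by
        have := hI.1.trans hJ.2.le
        gcongr
    _ ≤ detSize A ((letters J).dropLast ++ [(letters J).getLast hne]) := hlow _ _
    _ = _ := by rw [List.dropLast_append_getLast]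

/-- The upper ratio controls the norm of the linear part. -/
theorem exists_norm_linPart_le (h : AffineSetting φ X ρ A α) : ∃ a : ℝ, 1 ≤ a ∧
    (∀ J v, ‖linPart A J v‖ ≤ a * listRatio φ X ρ J * ‖v‖) ∧
    ∀ J K, 0 ≤ K → (∀ v, ‖linPart A J v‖ ≤ K * ‖v‖) → listRatio φ X ρ J ≤ a * K := by
  obtain ⟨a, ha, hbi⟩ := h.biLip
  have ha0 : 0 < a := by positivity
  have hlow : ∀ x ∈ X, ∀ y ∈ X, rdist ρ x y ≤ a * ‖x - y‖ := fun x hx y hy =>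
    (inv_mul_le_iff₀ ha0).1 (hbi x hx y hy).1
  refine ⟨a * a, by nlinarith, fun J v => ?_, fun J K hK hv => ?_⟩
  · have hR := listRatio_nonneg (φ := φ) (X := X) (ρ := ρ) J
    obtain ⟨t, ht, x, hx, y, hy, hxy⟩ := h.exists_smul_eq_sub v
    have h1 : ‖linPart A J (t • v)‖ ≤ a * a * listRatio φ X ρ J * ‖t • v‖ := by
      rw [hxy, ← h.sub_eq J hx hy]
      calc _ ≤ a * rdist ρ (listMap φ J x) (listMap φ J y) :=
            (hbi _ (mapsTo_listMap h.mapsTo J hx) _ (mapsTo_listMap h.mapsTo J hy)).2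
        _ ≤ a * (listRatio φ X ρ J * (a * ‖x - y‖)) := by
            gcongr
            exact (rdist_le_listRatio h.mifs.contracts J hx hy).trans
              (mul_le_mul_of_nonneg_left (hlow x hx y hy) hR)
        _ = _ := by ring
    rw [map_smul, norm_smul, norm_smul, Real.norm_of_nonneg ht.le] at h1
    refine le_of_mul_le_mul_left ?_ ht
    calc t * ‖linPart A J v‖ ≤ _ := h1
      _ = _ := by ring
  · refine listRatio_le (by positivity) fun x hx y hy => ?_
    calc _ ≤ a * ‖listMap φ J x - listMap φ J y‖ :=
          hlow _ (mapsTo_listMap h.mapsTo J hx) _ (mapsTo_listMap h.mapsTo J hy)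
      _ ≤ a * (K * (a * rdist ρ x y)) := by
          rw [h.sub_eq J hx hy]
          gcongr
          exact (hv _).trans (mul_le_mul_of_nonneg_left (hbi x hx y hy).2 hK)
      _ = _ := by ring

/-- A_J⁻¹ = A_I⁻¹(A_I A_J⁻¹) with the second factor bounded by homogeneity. Thus determinant size
controls R_J up to a constant, the link between Γ_b and 𝓘_b. -/
theorem exists_listRatio_le_of_comparable (h : AffineSetting φ X ρ A α) {κ : ℝ} (hκ : 0 < κ) :
    ∃ T : ℝ, 1 ≤ T ∧ ∀ I J, κ * detSize A I ≤ detSize A J → κ * detSize A J ≤ detSize A I →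
      listRatio φ X ρ J ≤ T * listRatio φ X ρ I := by
  obtain ⟨T, hT1, hT⟩ := h.exists_norm_le hκ
  obtain ⟨a, ha, h1, h2⟩ := h.exists_norm_linPart_le
  refine ⟨a * a * T, by nlinarith [mul_le_mul ha hT1 zero_le_one (by linarith)],
    fun I J hIJ hJI => ?_⟩
  have hR := listRatio_nonneg (φ := φ) (X := X) (ρ := ρ) I
  have ha0 : 0 ≤ a := by linarith
  refine (h2 J (a * listRatio φ X ρ I * T) (by positivity) fun v => ?_).trans_eq (by ring)
  have h3 := h1 I ((linPart A I).symm (linPart A J v))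
  rw [ContinuousLinearEquiv.apply_symm_apply] at h3
  rw [mul_assoc]
  exact h3.trans (mul_le_mul_of_nonneg_left (hT I J hIJ hJI v) (by positivity))

theorem exists_listRatio_le_letter (h : AffineSetting φ X ρ A α) :
    ∃ K : ℝ, 0 < K ∧ ∀ J k, listRatio φ X ρ J ≤ K * listRatio φ X ρ (J ++ [k]) := by
  obtain ⟨a, ha, h1, h2⟩ := h.exists_norm_linPart_le
  set S : ℝ := ∑ k, ‖((linPart A [k]).symm : Euc d →L[ℝ] Euc d)‖ with hS
  have hS0 : 0 ≤ S := Finset.sum_nonneg fun _ _ => norm_nonneg _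
  refine ⟨a * a * (S + 1), by positivity, fun J k => ?_⟩
  have hR := listRatio_nonneg (φ := φ) (X := X) (ρ := ρ) (J ++ [k])
  refine (h2 J (a * listRatio φ X ρ (J ++ [k]) * (S + 1)) (by positivity)
    fun v => ?_).trans_eq (by ring)
  have h3 := h1 (J ++ [k]) ((linPart A [k]).symm v)
  rw [linPart_append, ContinuousLinearEquiv.apply_symm_apply] at h3
  rw [mul_assoc (a * _)]
  refine h3.trans (mul_le_mul_of_nonneg_left ?_ (by positivity))
  refine (((linPart A [k]).symm : Euc d →L[ℝ] Euc d).le_opNorm v).trans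
    (mul_le_mul_of_nonneg_right ?_ (norm_nonneg _))
  have := Finset.single_le_sum (f := fun k => ‖((linPart A [k]).symm : Euc d →L[ℝ] Euc d)‖)
    (fun _ _ => norm_nonneg _) (Finset.mem_univ k)
  rw [← hS] at this
  linarith

theorem listRatio_pos (h : AffineSetting φ X ρ A α) (J : List (Fin m)) :
    0 < listRatio φ X ρ J := by
  refine lt_of_le_of_ne (listRatio_nonneg J) fun h0 => ?_
  obtain ⟨a, ha, h1, -⟩ := h.exists_norm_linPart_le
  have : Nonempty (Fin d) := ⟨⟨0, h.dim⟩⟩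
  obtain ⟨v, hv⟩ := exists_ne (0 : Euc d)
  have h2 := h1 J v
  rw [← h0, mul_zero, zero_mul, norm_le_zero_iff] at h2
  exact hv ((map_eq_zero_iff _ (linPart A J).injective).1 h2)

/-- If J has the smaller size, it has a prefix of size comparable to I, whose upper ratio is then at
most T b. The ratio of J itself exceeds b / K, so only boundedly many letters follow the prefix, and
each costs at most a factor t in size. -/
theorem cut_comparable (h : AffineSetting φ X ρ A α) : ∃ κ > 0, ∀ b : ℝ, 0 < b → b < 1 →
    ∀ I ∈ (MapSeq.const φ).cut X ρ b, ∀ J ∈ (MapSeq.const φ).cut X ρ b,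
      κ * detSize A (letters I) ≤ detSize A (letters J) := by
  obtain ⟨η, hη, hpre⟩ := h.scaledIFS.exists_prefix
  obtain ⟨T, hT1, hT⟩ := h.exists_listRatio_le_of_comparable (κ := min η 1) (by positivity)
  obtain ⟨K, hK, hKR⟩ := h.exists_listRatio_le_letter
  obtain ⟨c, hc0, hc1, -, hcR⟩ := exists_listRatio_append_le h.mifs.contracts
  obtain ⟨t, ht, htk⟩ := exists_pos_le_of_finite (fun k : Fin m => detSize A [k])
    fun k => detSize_pos A _
  obtain ⟨L, hL⟩ := exists_pow_lt_of_lt_one (show 0 < 1 / (K * T) by positivity) hc1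
  have htR : ∀ R : List (Fin m), t ^ R.length ≤ detSize A R := by
    intro R
    induction R with
    | nil => simp
    | cons k R ih =>
      rw [List.length_cons, pow_succ', ← List.singleton_append, detSize_append]
      exact mul_le_mul (htk k) ih (by positivity) (detSize_pos A _).le
  have z : Fin m := ⟨0, two_pos.trans_le (h.mifs.two_le 0)⟩
  have ht1 : t ≤ 1 := (htk z).trans (h.detSize_le_one _)
  refine ⟨min 1 (η * t ^ L), by positivity, fun b hb _ I hI J hJ => ?_⟩
  rw [mem_cut_const] at hI hJ
  have hsI := detSize_pos A (letters I)
  rcases le_total (detSize A (letters I)) (detSize A (letters J)) with hle | hle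
  · exact (mul_le_of_le_one_left hsI.le (min_le_left _ _)).trans hle
  have hne : letters J ≠ [] := by
    intro h0
    rw [h0] at hJ
    exact absurd hJ.1 (not_le.2 hJ.2)
  have hb1 : b < K * listRatio φ X ρ (letters J) := by
    have := hKR (letters J).dropLast ((letters J).getLast hne)
    rw [List.dropLast_append_getLast] at this
    exact hJ.2.trans_le this
  obtain ⟨j, J', hJ'⟩ := List.exists_cons_of_ne_nil hne
  rw [hJ'] at hle hb1 ⊢
  obtain ⟨P, R, rfl, h1, h2⟩ := hpre _ _ _ hle
  have h3 := hT (letters I) (j :: P)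
    ((mul_le_mul_of_nonneg_right (min_le_left _ _) hsI.le).trans h1)
    ((mul_le_of_le_one_left (detSize_pos A _).le (min_le_right _ _)).trans h2)
  have h4 := hcR (j :: P) R
  rw [List.cons_append] at h4
  have h5 : b < K * T * c ^ R.length * b := by
    calc b < K * listRatio φ X ρ (j :: (P ++ R)) := hb1
      _ ≤ K * (listRatio φ X ρ (j :: P) * c ^ R.length) := by gcongr
      _ ≤ K * (T * b * c ^ R.length) := by
          gcongr
          exact h3.trans (mul_le_mul_of_nonneg_left hI.1 (by linarith))
      _ = _ := by ring
  have h6 : 1 / (K * T) < c ^ R.length := by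
    rw [div_lt_iff₀ (by positivity)]
    by_contra hcon
    nlinarith [not_lt.1 hcon]
  have h7 : R.length ≤ L := by
    by_contra hcon
    exact absurd (hL.trans h6) (not_lt.2 (pow_le_pow_of_le_one hc0.le hc1.le (by omega)))
  rw [← List.cons_append, detSize_append]
  calc min 1 (η * t ^ L) * detSize A (letters I) ≤ η * t ^ L * detSize A (letters I) :=
        mul_le_mul_of_nonneg_right (min_le_right _ _) hsI.le
    _ = η * detSize A (letters I) * t ^ L := by ring
    _ ≤ detSize A (j :: P) * detSize A R :=
        mul_le_mul h1 ((pow_le_pow_of_le_one ht.le ht1 h7).trans (htR R)) (by positivity)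
          (detSize_pos A _).le

theorem boundedComparable_of_detCut (h : AffineSetting φ X ρ A α)
    (hov : BoundedOverlap φ X (detCut A)) : BoundedComparable φ X (detSize A) := by
  classical
  refine h.scaledIFS.boundedComparable_of_boundedOverlap hov h.rigid fun κ hκ => ?_
  have z : Fin m := ⟨0, two_pos.trans_le (h.mifs.two_le 0)⟩
  set q := min κ 1 / 2 with hq
  have hq0 : 0 < q := by positivity
  have hqκ : 2 * q ≤ κ := by rw [hq]; linarith [min_le_left κ 1]
  have hq1 : 2 * q ≤ 1 := by rw [hq]; linarith [min_le_right κ 1]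
  -- With b = q s(I), comparability gives q κ s(J) ≤ b < s(J).
  obtain ⟨L, hL⟩ := h.exists_detCut_extension z (q := q * κ) (by positivity)
  refine ⟨(Finset.range (L + 1)).image fun k => List.replicate k z,
    fun I => ⟨q * detSize A I, ?_, ?_, fun J hIJ hJI => ?_⟩⟩
  · exact mul_pos hq0 (detSize_pos A I)
  · nlinarith [h.detSize_le_one I, detSize_pos A I]
  · obtain ⟨k, hk, hmem⟩ := hL J (q * detSize A I) (mul_pos hq0 (detSize_pos A I))
      (by rw [mul_assoc]; gcongr) (by nlinarith [detSize_pos A I])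
    exact ⟨_, Finset.mem_image_of_mem _ (Finset.mem_range.2 (Nat.lt_succ_of_le hk)), hmem⟩

theorem boundedComparable_of_cut (h : AffineSetting φ X ρ A α)
    (hov : BoundedOverlap φ X ((MapSeq.const φ).cut X ρ)) :
    BoundedComparable φ X (detSize A) := by
  classical
  refine h.scaledIFS.boundedComparable_of_boundedOverlap hov h.rigid fun κ hκ => ?_
  have z : Fin m := ⟨0, two_pos.trans_le (h.mifs.two_le 0)⟩
  obtain ⟨T, hT1, hT⟩ := h.exists_listRatio_le_of_comparable hκ
  obtain ⟨c, hc0, hc1, hR1, hcR⟩ := exists_listRatio_append_le h.mifs.contracts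
  obtain ⟨L, hL⟩ := exists_pow_lt_of_lt_one (show 0 < 1 / (T * (2 * T)) by positivity) hc1
  -- R_I / (2T) lies strictly below R_J ≥ R_I / T for every comparable J, and L further letters
  -- bring R_J ≤ T R_I below it.
  refine ⟨(Finset.range (L + 1)).image fun k => List.replicate k z,
    fun I => ⟨listRatio φ X ρ I / (2 * T), ?_, ?_, fun J hIJ hJI => ?_⟩⟩
  · have := h.listRatio_pos I
    positivity
  · rw [div_lt_one (by positivity)]
    linarith [hR1 I]
  · have hRI := h.listRatio_pos I
    have hRJ := h.listRatio_pos J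
    have h1 := hT I J hIJ hJI
    have h2 := hT J I hJI hIJ
    obtain ⟨k, hk, hk1, hk2⟩ := exists_replicate_extension (listRatio φ X ρ) z (L := L)
      (b := listRatio φ X ρ I / (2 * T)) (J := J) (by
        rw [div_lt_iff₀ (by positivity)]
        nlinarith) (by
        refine (hcR _ _).trans ?_
        rw [List.length_replicate]
        calc listRatio φ X ρ J * c ^ L ≤ T * listRatio φ X ρ I * (1 / (T * (2 * T))) :=
              mul_le_mul h1 hL.le (by positivity) (by positivity)
          _ = _ := by field_simp)
    refine ⟨_, Finset.mem_image_of_mem _ (Finset.mem_range.2 (Nat.lt_succ_of_le hk)), ?_⟩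
    refine mem_cut_const.2 ?_
    have e : letters (ofLetters (J ++ List.replicate k z)) = _ := letters_ofLetters _
    rw [e]
    exact ⟨hk1, hk2⟩

end AffineSetting

theorem selfAffine_mosc_iff_osc (hd : 1 ≤ d) {φ : Fin m → Euc d → Euc d} {X : Set (Euc d)}
    {ρ : MetricSpace (Euc d)} {A : Fin m → (Euc d ≃L[ℝ] Euc d)} {α : Fin m → Euc d}
    (hM : (MapSeq.const φ).IsMIFS X ρ) (hρ : BiLipEquivOn ρ X) (hA : IsGenSelfAffine φ X A α)
    (hh : WeaklyHomogeneous A) : (MapSeq.const φ).MOSC X ↔ OSC φ X := by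
  refine ⟨fun h => ?_, mosc_of_osc⟩
  have hvol : 0 < volume X := by
    obtain ⟨V, hV, -, -, hpos⟩ := h
    exact (hpos.trans_le (iInf_le _ 0)).trans_le (measure_mono (hV 0).2)
  exact (AffineSetting.mk hd hM hρ hA hh hvol).scaledIFS.osc_of_mosc h

theorem selfAffine_mwsc_iff_wsc (hd : 1 ≤ d) {φ : Fin m → Euc d → Euc d} {X : Set (Euc d)}
    {ρ : MetricSpace (Euc d)} {A : Fin m → (Euc d ≃L[ℝ] Euc d)} {α : Fin m → Euc d}
    (hM : (MapSeq.const φ).IsMIFS X ρ) (hρ : BiLipEquivOn ρ X) (hA : IsGenSelfAffine φ X A α)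
    (hh : WeaklyHomogeneous A) : (MapSeq.const φ).MWSC X ρ ↔ WSC φ X (detCut A) := by
  constructor
  · intro h
    have hov := boundedOverlap_of_mwsc h
    have hset := AffineSetting.mk hd hM hρ hA hh hov.volume_pos
    exact wsc_of_boundedNeighbours hM.compact hov.volume_pos
      ((hset.boundedComparable_of_cut hov).boundedNeighbours hset.detCut_comparable)
  · intro h
    have hov := boundedOverlap_of_wsc h
    have hset := AffineSetting.mk hd hM hρ hA hh hov.volume_pos
    exact mwsc_of_boundedNeighbours hM.compact hov.volume_pos
      ((hset.boundedComparable_of_detCut hov).boundedNeighbours hset.cut_comparable)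

end Affine

/-! ### The self-conformal case with bounded distortion. -/

section Conformal

variable {d m : ℕ}

theorem rdist_eucMetric (x y : Euc d) : rdist (eucMetric d) x y = ‖x - y‖ := dist_eq_norm x y

theorem nontrivial_euc (hd : 1 ≤ d) : Nontrivial (Euc d) := by
  have : Nonempty (Fin d) := ⟨⟨0, hd⟩⟩
  infer_instance

theorem norm_map_of_isConformalMap (hd : 1 ≤ d) {f : Euc d →L[ℝ] Euc d} (hf : IsConformalMap f) :
    0 < ‖f‖ ∧ ∀ v, ‖f v‖ = ‖f‖ * ‖v‖ := by
  have := nontrivial_euc hd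
  obtain ⟨c, hc, li, rfl⟩ := hf
  have h1 : ‖c • li.toContinuousLinearMap‖ = ‖c‖ := by
    rw [norm_smul, LinearIsometry.norm_toContinuousLinearMap, mul_one]
  refine ⟨by rw [h1]; exact norm_pos_iff.2 hc, fun v => ?_⟩
  rw [h1]
  simp [norm_smul]

/-- The unit ball is mapped onto the ball of radius r; compare volumes. -/
theorem abs_det_of_norm_map {f : Euc d →L[ℝ] Euc d} {r : ℝ} (hr : 0 < r)
    (hf : ∀ v, ‖f v‖ = r * ‖v‖) : |f.det| = r ^ d := by
  have hinj : Function.Injective (f : Euc d →ₗ[ℝ] Euc d) := by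
    refine (injective_iff_map_eq_zero _).2 fun v hv => ?_
    have h1 := hf v
    have h2 : f v = 0 := hv
    rw [h2, norm_zero] at h1
    have := (mul_eq_zero.1 h1.symm).resolve_left hr.ne'
    exact norm_eq_zero.1 this
  have hsurj := LinearMap.surjective_of_injective hinj
  have himg : (f : Euc d →ₗ[ℝ] Euc d) '' Metric.ball 0 1 = Metric.ball 0 r := by
    ext w
    constructor
    · rintro ⟨v, hv, rfl⟩
      rw [mem_ball_zero_iff] at hv ⊢
      calc ‖f v‖ = r * ‖v‖ := hf v
        _ < r := mul_lt_of_lt_one_right hr hv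
    · intro hw
      obtain ⟨v, rfl⟩ := hsurj w
      refine ⟨v, ?_, rfl⟩
      rw [mem_ball_zero_iff] at hw ⊢
      have h1 : r * ‖v‖ < r := (hf v).symm.trans_lt hw
      by_contra hcon
      nlinarith [not_lt.1 hcon]
  have h1 := Measure.addHaar_image_linearMap volume (f : Euc d →ₗ[ℝ] Euc d) (Metric.ball 0 1)
  rw [himg, Measure.addHaar_ball_of_pos _ _ hr, finrank_euclideanSpace_fin] at h1
  have h2 := (ENNReal.mul_left_inj (Metric.measure_ball_pos volume (0 : Euc d) one_pos).ne'
    Metric.isBounded_ball.measure_lt_top.ne).1 h1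
  rw [ENNReal.ofReal_eq_ofReal_iff (by positivity) (abs_nonneg _)] at h2
  exact h2.symm

/-- A self-conformal system with bounded distortion on a set of positive volume. -/
structure ConformalSetting (φ : Fin m → Euc d → Euc d) (X X₁ : Set (Euc d)) : Prop where
  dim : 1 ≤ d
  selfConformal : IsSelfConformal φ X X₁
  distortion : BDP φ X₁
  volume_pos : 0 < volume X

namespace ConformalSetting

variable {φ : Fin m → Euc d → Euc d} {X X₁ : Set (Euc d)}

theorem subset_interior (h : ConformalSetting φ X X₁) : X ⊆ interior X₁ :=
  h.selfConformal.subset_interior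

theorem mapsTo (h : ConformalSetting φ X X₁) : ∀ j, MapsTo (φ j) X X :=
  contractsOn_mapsTo h.selfConformal.mifs.contracts

theorem isCompact (h : ConformalSetting φ X X₁) : IsCompact X := h.selfConformal.mifs.compact

/-- A conformal derivative is injective, hence surjective in finite dimension, and a C¹ map with
surjective derivative is locally open. -/
theorem isOpen_image (h : ConformalSetting φ X X₁) (j : Fin m) {V : Set (Euc d)}
    (hVX : V ⊆ interior X₁) (hV : IsOpen V) : IsOpen (φ j '' V) := by
  rw [isOpen_iff_mem_nhds]
  rintro _ ⟨x, hx, rfl⟩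
  have hO : interior X₁ ∈ 𝓝 x := isOpen_interior.mem_nhds (hVX hx)
  have hstrict : HasStrictFDerivAt (φ j) (fderiv ℝ (φ j) x) x :=
    ((h.selfConformal.contDiffOn j).contDiffAt hO).hasStrictFDerivAt one_ne_zero
  obtain ⟨f', hf', hconf⟩ := h.selfConformal.conformal j x (hVX hx)
  rw [hf'.fderiv] at hstrict
  have hnorm := norm_map_of_isConformalMap h.dim hconf
  have hinj : Function.Injective (f' : Euc d →ₗ[ℝ] Euc d) := hconf.injective
  have hsurj : f'.range = ⊤ := LinearMap.range_eq_top.2 (LinearMap.surjective_of_injective hinj)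
  rw [← hstrict.map_nhds_eq_of_surj hsurj]
  exact image_mem_map (hV.mem_nhds hx)

theorem mapsTo_interior (h : ConformalSetting φ X X₁) (j : Fin m) :
    MapsTo (φ j) (interior X₁) (interior X₁) := by
  rw [mapsTo_iff_image_subset]
  exact interior_maximal ((image_mono interior_subset).trans
    (contractsOn_mapsTo h.selfConformal.contracts j).image_subset)
    (h.isOpen_image j Subset.rfl isOpen_interior)

theorem conformalAt_listMap (h : ConformalSetting φ X X₁) (J : List (Fin m)) {x : Euc d}
    (hx : x ∈ interior X₁) : ConformalAt (listMap φ J) x := by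
  induction J with
  | nil => exact conformalAt_id x
  | cons j J ih =>
    exact ConformalAt.comp x
      (h.selfConformal.conformal j _ (mapsTo_listMap h.mapsTo_interior J hx)) ih

theorem hasFDerivAt_listMap (h : ConformalSetting φ X X₁) (J : List (Fin m)) {x : Euc d}
    (hx : x ∈ interior X₁) : HasFDerivAt (listMap φ J) (fderiv ℝ (listMap φ J) x) x :=
  (h.conformalAt_listMap J hx).differentiableAt.hasFDerivAt

theorem norm_fderiv_apply (h : ConformalSetting φ X X₁) (J : List (Fin m)) {x : Euc d}
    (hx : x ∈ interior X₁) : 0 < ‖fderiv ℝ (listMap φ J) x‖ ∧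
      ∀ v, ‖fderiv ℝ (listMap φ J) x v‖ = ‖fderiv ℝ (listMap φ J) x‖ * ‖v‖ := by
  obtain ⟨f', hf', hconf⟩ := h.conformalAt_listMap J hx
  rw [hf'.fderiv]
  exact norm_map_of_isConformalMap h.dim hconf

theorem norm_fderiv_append (h : ConformalSetting φ X X₁) (I J : List (Fin m)) {x : Euc d}
    (hx : x ∈ interior X₁) : ‖fderiv ℝ (listMap φ (I ++ J)) x‖ =
      ‖fderiv ℝ (listMap φ I) (listMap φ J x)‖ * ‖fderiv ℝ (listMap φ J) x‖ := by
  have := nontrivial_euc h.dim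
  obtain ⟨v, hv⟩ := exists_ne (0 : Euc d)
  have hJx := mapsTo_listMap h.mapsTo_interior J hx
  have hcomp := (h.hasFDerivAt_listMap I hJx).comp x (h.hasFDerivAt_listMap J hx)
  have h1 := (h.norm_fderiv_apply (I ++ J) hx).2 v
  rw [listMap_append] at h1 ⊢
  rw [hcomp.fderiv] at h1 ⊢
  rw [ContinuousLinearMap.comp_apply, (h.norm_fderiv_apply I hJx).2,
    (h.norm_fderiv_apply J hx).2, ← mul_assoc] at h1
  exact (mul_right_cancel₀ (norm_ne_zero_iff.2 hv) h1).symm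

theorem exists_distortion (h : ConformalSetting φ X X₁) : ∃ C : ℝ, 1 ≤ C ∧
    ∀ J, ∀ x ∈ interior X₁, ∀ y ∈ interior X₁,
      ‖fderiv ℝ (listMap φ J) x‖ ≤ C * ‖fderiv ℝ (listMap φ J) y‖ := by
  obtain ⟨C, hC⟩ := h.distortion
  have hC' : ∀ J, ∀ x ∈ interior X₁, ∀ y ∈ interior X₁,
      ‖fderiv ℝ (listMap φ J) x‖ ≤ C * ‖fderiv ℝ (listMap φ J) y‖ := by
    intro J x hx y hy
    have e : (MapSeq.const φ).wordMap (ofLetters J) = listMap φ J :=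
      (wordMap_const φ (ofLetters J)).trans (congrArg (listMap φ) (letters_ofLetters J))
    have := hC (ofLetters J) x hx y hy
    rwa [e] at this
  obtain ⟨p, hp⟩ := h.selfConformal.mifs.nonempty
  have hp' := h.subset_interior hp
  have h1 := hC' [] p hp' p hp'
  refine ⟨C, ?_, hC'⟩
  exact (le_mul_iff_one_le_left (h.norm_fderiv_apply [] hp').1).1 h1

theorem norm_fderiv_le_one (h : ConformalSetting φ X X₁) (J : List (Fin m)) {x : Euc d}
    (hx : x ∈ interior X₁) : ‖fderiv ℝ (listMap φ J) x‖ ≤ 1 := by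
  obtain ⟨c, hc0, hc1, hc⟩ := contractsOn_exists_ratio h.selfConformal.contracts
  refine (h.hasFDerivAt_listMap J hx).le_of_lip' zero_le_one ?_
  filter_upwards [isOpen_interior.mem_nhds hx] with y hy
  have := hc J y (interior_subset hy) x (interior_subset hx)
  rw [rdist_eucMetric, rdist_eucMetric] at this
  exact this.trans (mul_le_mul_of_nonneg_right (pow_le_one₀ hc0.le hc1.le) (norm_nonneg _))

/-- The maps `φ_J` are Lipschitz on `X` with a constant comparable to their derivatives, although
`X` need not be connected. -/
theorem exists_lipschitz (h : ConformalSetting φ X X₁) {p : Euc d} (hp : p ∈ X) :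
    ∃ D : ℝ, 0 < D ∧ ∀ J, ∀ x ∈ X, ∀ y ∈ X,
      ‖listMap φ J x - listMap φ J y‖ ≤ D * ‖fderiv ℝ (listMap φ J) p‖ * ‖x - y‖ := by
  obtain ⟨C, hC1, hC⟩ := h.exists_distortion
  have hpO := h.subset_interior hp
  obtain ⟨c, hc0, hc1, hc⟩ := contractsOn_exists_ratio h.selfConformal.mifs.contracts
  simp only [rdist_eucMetric] at hc
  -- The last n letters of a long word bring any two points of X within δ, hence into a ball inside
  -- the interior of X₁, where the mean value inequality holds for the remaining map. Words of at
  -- most n letters are finite in number.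
  obtain ⟨δ, hδ, hthick⟩ := h.isCompact.exists_thickening_subset_open isOpen_interior
    h.subset_interior
  obtain ⟨n, hn⟩ := exists_pow_lt_of_lt_one
    (show 0 < δ / (Metric.diam X + 1) by have := Metric.diam_nonneg (s := X); positivity) hc1
  have hdiam : 0 < Metric.diam X + 1 := by have := Metric.diam_nonneg (s := X); positivity
  rw [lt_div_iff₀ hdiam] at hn
  have hfin : Finite {J : List (Fin m) // J.length ≤ n} :=
    (List.finite_length_le (Fin m) n).to_subtype
  obtain ⟨θ, hθ, hθJ⟩ := exists_pos_le_of_finite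
    (fun J : {J : List (Fin m) // J.length ≤ n} => ‖fderiv ℝ (listMap φ J.1) p‖)
    fun J => (h.norm_fderiv_apply J.1 hpO).1
  have hone : ∀ J, ∀ x ∈ X, ∀ y ∈ X, ‖listMap φ J x - listMap φ J y‖ ≤ ‖x - y‖ :=
    fun J x hx y hy => (hc J x hx y hy).trans
      (mul_le_of_le_one_left (norm_nonneg _) (pow_le_one₀ hc0.le hc1.le))
  refine ⟨C * C / θ, by positivity, fun J x hx y hy => ?_⟩
  have hxy := norm_nonneg (x - y)
  rcases le_or_gt J.length n with hJ | hJ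
  · refine (hone J x hx y hy).trans (le_mul_of_one_le_left hxy ?_)
    rw [div_mul_eq_mul_div, one_le_div hθ]
    have := hθJ ⟨J, hJ⟩
    simp only at this
    nlinarith [mul_le_mul hC1 hC1 zero_le_one (by linarith)]
  · obtain ⟨I, R, rfl, hR⟩ : ∃ I R, J = I ++ R ∧ R.length = n :=
      ⟨J.take (J.length - n), J.drop (J.length - n), by simp, by simp; omega⟩
    have hRx := mapsTo_listMap h.mapsTo R hx
    have hRy := mapsTo_listMap h.mapsTo R hy
    have hball : Metric.ball (listMap φ R x) δ ⊆ interior X₁ :=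
      (Metric.ball_subset_thickening hRx δ).trans hthick
    have hyball : listMap φ R y ∈ Metric.ball (listMap φ R x) δ := by
      rw [mem_ball_iff_norm']
      calc _ ≤ c ^ R.length * ‖x - y‖ := hc R x hx y hy
        _ ≤ c ^ n * (Metric.diam X + 1) := by
            rw [hR, ← dist_eq_norm]
            have := Metric.dist_le_diam_of_mem h.isCompact.isBounded hx hy
            gcongr
            linarith
        _ < δ := hn
    have h1 := (convex_ball (listMap φ R x) δ).norm_image_sub_le_of_norm_hasFDerivWithin_le
      (f := listMap φ I) (f' := fun z => fderiv ℝ (listMap φ I) z)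
      (C := C * ‖fderiv ℝ (listMap φ I) (listMap φ R p)‖)
      (fun z hz => (h.hasFDerivAt_listMap I (hball hz)).hasFDerivWithinAt)
      (fun z hz => hC I z (hball hz) _ (h.subset_interior (mapsTo_listMap h.mapsTo R hp)))
      hyball (Metric.mem_ball_self hδ)
    have h2 := h.norm_fderiv_append I R hpO
    have h3 := hθJ ⟨R, hR.le⟩
    simp only at h3
    have h4 := norm_nonneg (fderiv ℝ (listMap φ I) (listMap φ R p))
    have h5 : ‖fderiv ℝ (listMap φ I) (listMap φ R p)‖ * θ ≤
        ‖fderiv ℝ (listMap φ (I ++ R)) p‖ := by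
      rw [h2]
      gcongr
    rw [listMap_append] at h5 ⊢
    simp only [Function.comp_apply]
    calc _ ≤ C * ‖fderiv ℝ (listMap φ I) (listMap φ R p)‖ *
          ‖listMap φ R x - listMap φ R y‖ := h1
      _ ≤ C * ‖fderiv ℝ (listMap φ I) (listMap φ R p)‖ * ‖x - y‖ := by
          gcongr
          exact hone R x hx y hy
      _ ≤ C * C / θ * ‖fderiv ℝ (listMap φ I ∘ listMap φ R) p‖ * ‖x - y‖ := by
          refine mul_le_mul_of_nonneg_right ?_ (norm_nonneg _)
          rw [div_mul_eq_mul_div, le_div_iff₀ hθ]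
          calc _ = C * (‖fderiv ℝ (listMap φ I) (listMap φ R p)‖ * θ) := by ring
            _ ≤ C * ‖fderiv ℝ (listMap φ I ∘ listMap φ R) p‖ := by gcongr
            _ ≤ C * C * _ := by gcongr; nlinarith

theorem scaledIFS (h : ConformalSetting φ X X₁) {p : Euc d} (hp : p ∈ X) :
    ScaledIFS φ X fun J => ‖fderiv ℝ (listMap φ J) p‖ where
  isCompact := h.isCompact
  mapsTo := h.mapsTo
  injOn := contractsOn_injOn h.selfConformal.mifs.contracts
  continuousOn := contractsOn_continuousOn h.selfConformal.mifs.contracts (biLipEquivOn_eucMetric X)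
  isOpen_image := fun j V hVX hV => h.isOpen_image j (hVX.trans h.subset_interior) hV
  pos := fun J => (h.norm_fderiv_apply J (h.subset_interior hp)).1
  bounded := ⟨1, fun J => h.norm_fderiv_le_one J (h.subset_interior hp)⟩
  quasiMul := by
    obtain ⟨C, hC1, hC⟩ := h.exists_distortion
    have hpO := h.subset_interior hp
    refine ⟨C, hC1, fun I J => ?_⟩
    have hJ := mapsTo_listMap h.mapsTo_interior J hpO
    rw [h.norm_fderiv_append I J hpO, ← mul_assoc, ← mul_assoc]
    exact ⟨mul_le_mul_of_nonneg_right (hC I _ hJ _ hpO) (norm_nonneg _),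
      mul_le_mul_of_nonneg_right (hC I _ hpO _ hJ) (norm_nonneg _)⟩
  volume_image := by
    obtain ⟨C, hC1, hC⟩ := h.exists_distortion
    have hpO := h.subset_interior hp
    -- By change of variables, the Jacobian being |φ_J'(x)|^d ≥ (C⁻¹ |φ_J'(p)|)^d.
    refine ⟨(C⁻¹) ^ d, by positivity, fun J U hU hUm => ?_⟩
    rw [← lintegral_abs_det_fderiv_eq_addHaar_image volume hUm
      (fun x hx => (h.hasFDerivAt_listMap J (h.subset_interior (hU hx))).hasFDerivWithinAt)
      ((injOn_listMap h.mapsTo (contractsOn_injOn h.selfConformal.mifs.contracts) J).mono hU),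
      ← setLIntegral_const]
    refine setLIntegral_mono' hUm fun x hx => ENNReal.ofReal_le_ofReal ?_
    have hxO := h.subset_interior (hU hx)
    have hx' := h.norm_fderiv_apply J hxO
    rw [abs_det_of_norm_map hx'.1 hx'.2, ← mul_pow]
    gcongr
    rw [inv_mul_le_iff₀ (by positivity)]
    exact hC J p hpO x hxO
  region := by
    intro κ hκ
    obtain ⟨D, hD, hlip⟩ := h.exists_lipschitz hp
    have hdiam : 0 ≤ Metric.diam X := Metric.diam_nonneg
    have hlip' : ∀ J, ∀ x ∈ X, ∀ y ∈ X, ‖listMap φ J x - listMap φ J y‖ ≤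
        D * ‖fderiv ℝ (listMap φ J) p‖ * Metric.diam X := fun J x hx y hy => by
      refine (hlip J x hx y hy).trans (mul_le_mul_of_nonneg_left ?_ (by positivity))
      rw [← dist_eq_norm]
      exact Metric.dist_le_diam_of_mem h.isCompact.isBounded hx hy
    have hfin : volume (Metric.ball (0 : Euc d) 1) ≠ ⊤ :=
      Metric.isBounded_ball.measure_lt_top.ne
    set E := D * Metric.diam X * (κ⁻¹ + 1) with hE
    have hE0 : 0 ≤ E := by positivity
    refine ⟨E ^ d * (volume (Metric.ball (0 : Euc d) 1)).toReal, by positivity, fun I =>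
      ⟨Metric.closedBall (listMap φ I p) (E * ‖fderiv ℝ (listMap φ I) p‖), ?_, ?_⟩⟩
    · rw [Measure.addHaar_closedBall _ _ (by positivity), finrank_euclideanSpace_fin,
        mul_right_comm (E ^ d), ← mul_pow, ENNReal.ofReal_mul (by positivity), ENNReal.ofReal_toReal hfin]
    · rintro J - hJI ⟨_, ⟨x, hx, rfl⟩, ⟨y, hy, hyx⟩⟩ _ ⟨w, hw, rfl⟩
      rw [mem_closedBall_iff_norm]
      have h1 := hlip' J w hw x hx
      have h2 := hlip' I y hy p hp
      have h3 : ‖fderiv ℝ (listMap φ J) p‖ ≤ κ⁻¹ * ‖fderiv ℝ (listMap φ I) p‖ := by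
        rwa [← div_eq_inv_mul, le_div_iff₀' hκ]
      calc ‖listMap φ J w - listMap φ I p‖ =
            ‖(listMap φ J w - listMap φ J x) + (listMap φ I y - listMap φ I p)‖ := by
              rw [hyx]; congr 1; abel
        _ ≤ D * (κ⁻¹ * ‖fderiv ℝ (listMap φ I) p‖) * Metric.diam X +
            D * ‖fderiv ℝ (listMap φ I) p‖ * Metric.diam X := by
              refine (norm_add_le _ _).trans (add_le_add (h1.trans ?_) h2)
              gcongr
        _ = _ := by rw [hE]; ring

/-- X is infinite and compact, so it has an accumulation point x in X. A conformal derivative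
stretches all directions equally, so difference quotients along points of X tending to x already
detect |φ_J'(x)|, which distortion compares with |φ_J'(p)|. -/
theorem exists_norm_fderiv_le_listRatio (h : ConformalSetting φ X X₁) {p : Euc d} (hp : p ∈ X) :
    ∃ C : ℝ, 0 < C ∧ ∀ J, ‖fderiv ℝ (listMap φ J) p‖ ≤ C * listRatio φ X (eucMetric d) J := by
  obtain ⟨C, hC1, hC⟩ := h.exists_distortion
  have hinf : X.Infinite := fun hfin => by
    have := nontrivial_euc h.dim
    exact h.volume_pos.ne' (hfin.measure_zero volume)
  obtain ⟨x, hx, hacc⟩ := hinf.exists_accPt_of_subset_isCompact h.isCompact Subset.rfl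
  have hxO := h.subset_interior hx
  refine ⟨C, by positivity, fun J => ?_⟩
  refine (hC J p (h.subset_interior hp) x hxO).trans (mul_le_mul_of_nonneg_left ?_ (by positivity))
  refine le_of_forall_pos_le_add fun ε hε => ?_
  have hder := (h.hasFDerivAt_listMap J hxO).isLittleO.def hε
  obtain ⟨y, ⟨hyx, hy⟩, hyd⟩ := ((accPt_iff_frequently.1 hacc).and_eventually hder).exists
  have hpos : 0 < ‖y - x‖ := norm_pos_iff.2 (sub_ne_zero.2 hyx)
  have h1 := rdist_le_listRatio h.selfConformal.mifs.contracts J hy hx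
  rw [rdist_eucMetric, rdist_eucMetric] at h1
  refine le_of_mul_le_mul_right ?_ hpos
  rw [← (h.norm_fderiv_apply J hxO).2, add_mul]
  calc _ ≤ ‖listMap φ J y - listMap φ J x‖ + ‖listMap φ J y - listMap φ J x -
        fderiv ℝ (listMap φ J) x (y - x)‖ := by
          rw [norm_sub_rev (listMap φ J y - listMap φ J x)]
          exact norm_le_norm_add_norm_sub' _ _
    _ ≤ _ := add_le_add h1 hyd

/-- R_J and |φ_J'(p)| are comparable in both directions, and deleting the last letter changes the
size by a bounded factor. -/
theorem cut_comparable (h : ConformalSetting φ X X₁) {p : Euc d} (hp : p ∈ X) :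
    ∃ κ > 0, ∀ b : ℝ, 0 < b → b < 1 → ∀ I ∈ (MapSeq.const φ).cut X (eucMetric d) b,
      ∀ J ∈ (MapSeq.const φ).cut X (eucMetric d) b,
        κ * ‖fderiv ℝ (listMap φ (letters I)) p‖ ≤ ‖fderiv ℝ (listMap φ (letters J)) p‖ := by
  obtain ⟨η, hη, hlow⟩ := (h.scaledIFS hp).exists_letter_lower
  obtain ⟨D, hD, hlip⟩ := h.exists_lipschitz hp
  obtain ⟨C, hC, hCR⟩ := h.exists_norm_fderiv_le_listRatio hp
  refine ⟨η / (D * C), by positivity, fun b hb _ I hI J hJ => ?_⟩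
  rw [mem_cut_const] at hI hJ
  have hne : letters J ≠ [] := by
    intro h0
    rw [h0] at hJ
    exact absurd hJ.1 (not_le.2 hJ.2)
  have h1 : listRatio φ X (eucMetric d) (letters J).dropLast ≤
      D * ‖fderiv ℝ (listMap φ (letters J).dropLast) p‖ := by
    refine listRatio_le (by positivity) fun x hx y hy => ?_
    rw [rdist_eucMetric, rdist_eucMetric]
    exact hlip _ x hx y hy
  have h2 := hlow (letters J).dropLast ((letters J).getLast hne)
  rw [List.dropLast_append_getLast] at h2
  rw [div_mul_eq_mul_div, div_le_iff₀ (by positivity)]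
  calc η * ‖fderiv ℝ (listMap φ (letters I)) p‖ ≤ η * (C * b) := by
        gcongr
        exact (hCR _).trans (by gcongr; exact hI.1)
    _ ≤ η * (C * (D * ‖fderiv ℝ (listMap φ (letters J).dropLast) p‖)) := by
        gcongr
        exact hJ.2.le.trans h1
    _ = η * ‖fderiv ℝ (listMap φ (letters J).dropLast) p‖ * (D * C) := by ring
    _ ≤ _ := by gcongr

theorem boundedNeighbours (h : ConformalSetting φ X X₁)
    (hov : BoundedOverlap φ X ((MapSeq.const φ).cut X (eucMetric d))) :
    BoundedNeighbours φ X ((MapSeq.const φ).cut X (eucMetric d)) := by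
  obtain ⟨p, hp⟩ := h.selfConformal.mifs.nonempty
  exact (h.scaledIFS hp).boundedNeighbours_of_boundedOverlap hov (h.cut_comparable hp)

end ConformalSetting

theorem selfConformal_mosc_iff_osc (hd : 1 ≤ d) {φ : Fin m → Euc d → Euc d} {X X₁ : Set (Euc d)}
    (hφ : IsSelfConformal φ X X₁) (hb : BDP φ X₁) : (MapSeq.const φ).MOSC X ↔ OSC φ X := by
  refine ⟨fun h => ?_, mosc_of_osc⟩
  have hvol : 0 < volume X := by
    obtain ⟨V, hV, -, -, hpos⟩ := h
    exact (hpos.trans_le (iInf_le _ 0)).trans_le (measure_mono (hV 0).2)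
  obtain ⟨p, hp⟩ := hφ.mifs.nonempty
  exact ((ConformalSetting.mk hd hφ hb hvol).scaledIFS hp).osc_of_mosc h

theorem selfConformal_mwsc_iff_wsc (hd : 1 ≤ d) {φ : Fin m → Euc d → Euc d} {X X₁ : Set (Euc d)}
    (hφ : IsSelfConformal φ X X₁) (hb : BDP φ X₁) : (MapSeq.const φ).MWSC X (eucMetric d) ↔
      WSC φ X ((MapSeq.const φ).cut X (eucMetric d)) := by
  constructor
  · intro h
    have hov := boundedOverlap_of_mwsc h
    exact wsc_of_boundedNeighbours hφ.mifs.compact hov.volume_pos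
      ((ConformalSetting.mk hd hφ hb hov.volume_pos).boundedNeighbours hov)
  · intro h
    have hov := boundedOverlap_of_wsc h
    exact mwsc_of_boundedNeighbours hφ.mifs.compact hov.volume_pos
      ((ConformalSetting.mk hd hφ hb hov.volume_pos).boundedNeighbours hov)

theorem selfConformal_mwsc_iff_pointwiseWSC (hd : 1 ≤ d) {φ : Fin m → Euc d → Euc d}
    {X X₁ : Set (Euc d)} (hφ : IsSelfConformal φ X X₁) (hb : BDP φ X₁)
    (hX : (interior X).Nonempty) : (MapSeq.const φ).MWSC X (eucMetric d) ↔
      PointwiseWSC φ X ((MapSeq.const φ).cut X (eucMetric d)) := by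
  constructor
  · intro h
    have hov := boundedOverlap_of_mwsc h
    exact pointwiseWSC_of_boundedNeighbours hX (contractsOn_mapsTo hφ.mifs.contracts)
      ((ConformalSetting.mk hd hφ hb hov.volume_pos).boundedNeighbours hov)
  · intro h
    have hov := boundedOverlap_of_pointwiseWSC h
    exact mwsc_of_boundedNeighbours hφ.mifs.compact hov.volume_pos
      ((ConformalSetting.mk hd hφ hb hov.volume_pos).boundedNeighbours hov)

end Conformal

end

theorem theorem3p7 (d : ℕ) (hd : 1 ≤ d) (m : ℕ) (φ : Fin m → Euc d → Euc d) (X : Set (Euc d)) :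
    -- generalized self-affine case
    (∀ (ρ : MetricSpace (Euc d)) (A : Fin m → (Euc d ≃L[ℝ] Euc d)) (α : Fin m → Euc d),
      (MapSeq.const φ).IsMIFS X ρ → BiLipEquivOn ρ X →
      IsGenSelfAffine φ X A α → WeaklyHomogeneous A →
        (∀ n, (MapSeq.const φ).attractor X n = (MapSeq.const φ).attractor X 0) ∧
        ((MapSeq.const φ).MOSC X ↔ OSC φ X) ∧
        ((MapSeq.const φ).MWSC X ρ ↔ WSC φ X (detCut A)) ∧
        ((MapSeq.const φ).MSSC X ↔ SSC φ X)) ∧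
    -- self-conformal case
    (∀ X₁ : Set (Euc d), IsSelfConformal φ X X₁ → BDP φ X₁ →
        (∀ n, (MapSeq.const φ).attractor X n = (MapSeq.const φ).attractor X 0) ∧
        ((MapSeq.const φ).MOSC X ↔ OSC φ X) ∧
        ((MapSeq.const φ).MWSC X (eucMetric d) ↔
          WSC φ X ((MapSeq.const φ).cut X (eucMetric d))) ∧
        ((interior X).Nonempty → ((MapSeq.const φ).MWSC X (eucMetric d) ↔
          PointwiseWSC φ X ((MapSeq.const φ).cut X (eucMetric d)))) ∧
        ((MapSeq.const φ).MSSC X ↔ SSC φ X)) := by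
  -- Every tail of a constant sequence is definitionally the sequence itself, so all K_n coincide by
  -- `rfl`.
  refine ⟨fun ρ A α hM hρ hA hh => ⟨fun _ => rfl, selfAffine_mosc_iff_osc hd hM hρ hA hh,
    selfAffine_mwsc_iff_wsc hd hM hρ hA hh, isMIFS_mssc_iff_ssc hM hρ⟩,
    fun X₁ hφ hb => ⟨fun _ => rfl, selfConformal_mosc_iff_osc hd hφ hb,
      selfConformal_mwsc_iff_wsc hd hφ hb, selfConformal_mwsc_iff_pointwiseWSC hd hφ hb,
      isMIFS_mssc_iff_ssc hφ.mifs (biLipEquivOn_eucMetric X)⟩⟩
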